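/- Fix an integer $n\ge 1$. Let $\mathbf J_m$ be the algebra on $\{\top,f_0,\dots,f_m,t_0,\dots,t_m,\bot\}$ with operations $\otimes,\oplus$ (meet and join of the knowledge order, in which $\bot<f_m<\dots<f_0<\top$ and $\bot<t_m<\dots<t_0<\top$ and no $f_i$ is comparable with any $t_j$), $\wedge,\vee$ (meet and join of the truth order, in which $f_0<\dots<f_m<\top,\bot<t_m<\dots<t_0$, with $\top$ and $\bot$ incomparable), $\neg$ (which fixes $\top,\bot$ and swaps $f_i$ and $t_i$), and every element named by a constant. Let $\mathcal V_n=\mathrm{HSP}(\mathbf J_n)$ be the variety generated by $\mathbf J_n$. For $0\le k\le n$ let $\mathbf M_k$ be the following algebra in the signature of $\mathbf J_n$. The operations $\otimes,\oplus,\wedge,\vee,\neg$ of $\mathbf M_0$ are those of $\mathbf J_0$, with elements written $\top,\mathbf f,\mathbf t,\bot$; those of $\mathbf M_k$, $k\ge1$, are those of $\mathbf J_1$, with $f_0,f_1,t_0,t_1$ written $\mathbf 0,\mathbf f,\mathbf 1,\mathbf t$. In every $\mathbf M_k$ the constants $\top,\bot$ take the values $\top,\bot$; in $\mathbf M_0$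 all constants $f_i$ take the value $\mathbf f$ and all $t_i$ the value $\mathbf t$; in $\mathbf M_k$, $k\ge 1$, the constants $f_i$, $t_i$ take the values $\mathbf 0$, $\mathbf 1$ if $i<k$ and $\mathbf f$, $\mathbf t$ if $i\ge k$. Let $\widetilde{\mathbf M}_n$ be the multi-sorted structure with sorts $M_0,\dots,M_n$, each with the discrete topology, equipped with - the homomorphisms $g_k\colon\mathbf M_k\to\mathbf M_0$, $1\le k\le n$, sending $\mathbf f,\mathbf 0$ to $\mathbf f$, sending $\mathbf t,\mathbf 1$ to $\mathbf t$, and fixing $\top$ and $\bot$; - the relation ${\le^0}=(M_0\times\{\top\})\cup(\{\bot\}\times M_0)\cup\{(\mathbf f,\mathbf f),(\mathbf t,\mathbf t)\}$ on $M_0$; - the relations $\le^k$ on $M_k$ ($1\le k\le n$) and $\le^{jk}$ from $M_j$ to $M_k$ ($1\le j<k\le n$), each having the underlying set $\{(\top,\top),(\bot,\bot),(\mathbf f,\mathbf f),(\mathbf f,\mathbf 0),(\mathbf 0,\mathbf 0),(\mathbf t,\mathbf t),(\mathbf t,\mathbf 1),(\mathbf 1,\mathbf 1)\}$. Let $\widetilde{\mathbf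 M}$ be any structure on these sorts, with the discrete topology, given by a set of homomorphisms between the $\mathbf M_k$ and a set of binary relations, each a subuniverse of some $\mathbf M_j\times\mathbf M_k$. For $\mathbf A\in\mathcal V_n$, let $\mathrm D(\mathbf A)$ be the multi-sorted topological structure whose $k$-th sort is the set of homomorphisms $\mathbf A\to\mathbf M_k$, with topology, operations and relations inherited pointwise from the power $\widetilde{\mathbf M}^A$, and let $\mathrm{ED}(\mathbf A)$ be the algebra, with pointwise operations, of all sort-preserving continuous maps $\mathrm D(\mathbf A)\to\widetilde{\mathbf M}$ that preserve the operations and relations. The structure $\widetilde{\mathbf M}$ *yields a (multi-sorted) duality on $\mathcal V_n$* if, for every $\mathbf A\in\mathcal V_n$, the evaluation homomorphism $e_{\mathbf A}\colon\mathbf A\to\mathrm{ED}(\mathbf A)$, $e_{\mathbf A}(a)(x)=x(a)$, is an isomorphism. **Theorem.** The multi-sorted alter ego $\widetilde{\mathbf M}_n$ yields an optimal duality on $\mathcal V_n$: it yields a duality on $\mathcal V_n$, and if any one of the maps $g_k$ ($1\le k\le n$) or of the relations $\le^k$ ($0\le k\le n$), $\le^{jk}$ ($1\le j<k\le n$) is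 removed from $\widetilde{\mathbf M}_n$, then the resulting structure no longer yields a duality on $\mathcal V_n$. -/

import Mathlib

universe u v w

namespace BilatticeDuality

/-! ### The bilattices `J m` and their signature -/

/-- The set `J_m = {⊤, f_0, …, f_m, t_0, …, t_m, ⊥}`. -/
inductive J (m : ℕ) : Type
  | top : J m
  | f : Fin (m + 1) → J m
  | t : Fin (m + 1) → J m
  | bot : J m
  deriving DecidableEq, Fintype

namespace J

variable {m : ℕ}

/-- The knowledge order: `⊥ < f_m < ⋯ < f_0 < ⊤` and `⊥ < t_m < ⋯ < t_0 < ⊤`, with no comparability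
between any `f_i` and any `t_j`. -/
def leK : J m → J m → Prop
  | bot, _ => True
  | _, top => True
  | f i, f j => j ≤ i
  | t i, t j => j ≤ i
  | _, _ => False

/-- The truth order: `f_0 < ⋯ < f_m < ⊤, ⊥ < t_m < ⋯ < t_0`, with `⊤` and `⊥` incomparable. -/
def leT : J m → J m → Prop
  | f i, f j => i ≤ j
  | f _, _ => True
  | t i, t j => j ≤ i
  | _, t _ => True
  | top, top => True
  | bot, bot => True
  | _, _ => False

/-- `⊗`, the meet of the knowledge order. -/
def otimes : J m → J m → J m
  | top, y => y
  | x, top => x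
  | f i, f j => f (max i j)
  | t i, t j => t (max i j)
  | _, _ => bot

/-- `⊕`, the join of the knowledge order. -/
def oplus : J m → J m → J m
  | bot, y => y
  | x, bot => x
  | f i, f j => f (min i j)
  | t i, t j => t (min i j)
  | _, _ => top

/-- `∧`, the meet of the truth order. -/
def meet : J m → J m → J m
  | f i, f j => f (min i j)
  | f i, _ => f i
  | _, f j => f j
  | t i, t j => t (max i j)
  | t _, y => y
  | x, t _ => x
  | top, top => top
  | bot, bot => bot
  | _, _ => f (Fin.last m)

/-- `∨`, the join of the truth order. -/
def join : J m → J m → J m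
  | t i, t j => t (min i j)
  | t i, _ => t i
  | _, t j => t j
  | f i, f j => f (max i j)
  | f _, y => y
  | x, f _ => x
  | top, top => top
  | bot, bot => bot
  | _, _ => t (Fin.last m)

/-- `¬`, which swaps `f_i` and `t_i` and fixes `⊤` and `⊥`. -/
def neg : J m → J m
  | top => top
  | f i => t i
  | t i => f i
  | bot => bot

/-- `x ⊗ y` is the greatest lower bound of `x`, `y` in the knowledge order. -/
theorem leK_otimes_iff (x y z : J m) : leK z (otimes x y) ↔ leK z x ∧ leK z y := by
  rcases x with _ | x | x | _ <;> rcases y with _ | y | y | _ <;> rcases z with _ | z | z | _ <;>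
    simp [leK, otimes]

/-- `x ⊕ y` is the least upper bound of `x`, `y` in the knowledge order. -/
theorem oplus_leK_iff (x y z : J m) : leK (oplus x y) z ↔ leK x z ∧ leK y z := by
  rcases x with _ | x | x | _ <;> rcases y with _ | y | y | _ <;> rcases z with _ | z | z | _ <;>
    simp [leK, oplus]

/-- `x ∧ y` is the greatest lower bound of `x`, `y` in the truth order. -/
theorem leT_meet_iff (x y z : J m) : leT z (meet x y) ↔ leT z x ∧ leT z y := by
  rcases x with _ | x | x | _ <;> rcases y with _ | y | y | _ <;> rcases z with _ | z | z | _ <;>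
    simp [leT, meet, Fin.le_last]

/-- `x ∨ y` is the least upper bound of `x`, `y` in the truth order. -/
theorem join_leT_iff (x y z : J m) : leT (join x y) z ↔ leT x z ∧ leT y z := by
  rcases x with _ | x | x | _ <;> rcases y with _ | y | y | _ <;> rcases z with _ | z | z | _ <;>
    simp [leT, join, Fin.le_last]

end J

/-- Algebras in the signature of `𝐉_n`: four binary operations, one unary operation, and a constant
for each element of `J_n`. (This is the bare signature; laws come from membership in the variety.) -/
class BiAlg (n : ℕ) (A : Type u) where
  otimes : A → A → A
  oplus : A → A → A
  meet : A → A → A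
  join : A → A → A
  neg : A → A
  const : J n → A

/-- The prioritised default bilattice `𝐉_n`. -/
instance (n : ℕ) : BiAlg n (J n) where
  otimes := J.otimes
  oplus := J.oplus
  meet := J.meet
  join := J.join
  neg := J.neg
  const := id

/-- Powers, with pointwise operations. -/
instance (n : ℕ) (I : Type u) (A : Type v) [BiAlg n A] : BiAlg n (I → A) where
  otimes x y := fun i => BiAlg.otimes n (x i) (y i)
  oplus x y := fun i => BiAlg.oplus n (x i) (y i)
  meet x y := fun i => BiAlg.meet n (x i) (y i)
  join x y := fun i => BiAlg.join n (x i) (y i)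
  neg x := fun i => BiAlg.neg n (x i)
  const c := fun _ => BiAlg.const c

/-- Binary products, with componentwise operations. -/
instance (n : ℕ) (A : Type u) (B : Type v) [BiAlg n A] [BiAlg n B] : BiAlg n (A × B) where
  otimes x y := (BiAlg.otimes n x.1 y.1, BiAlg.otimes n x.2 y.2)
  oplus x y := (BiAlg.oplus n x.1 y.1, BiAlg.oplus n x.2 y.2)
  meet x y := (BiAlg.meet n x.1 y.1, BiAlg.meet n x.2 y.2)
  join x y := (BiAlg.join n x.1 y.1, BiAlg.join n x.2 y.2)
  neg x := (BiAlg.neg n x.1, BiAlg.neg n x.2)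
  const c := (BiAlg.const c, BiAlg.const c)

/-- Homomorphisms. -/
@[ext]
structure Hom (n : ℕ) (A : Type u) (B : Type v) [BiAlg n A] [BiAlg n B] where
  toFun : A → B
  map_otimes : ∀ x y, toFun (BiAlg.otimes n x y) = BiAlg.otimes n (toFun x) (toFun y)
  map_oplus : ∀ x y, toFun (BiAlg.oplus n x y) = BiAlg.oplus n (toFun x) (toFun y)
  map_meet : ∀ x y, toFun (BiAlg.meet n x y) = BiAlg.meet n (toFun x) (toFun y)
  map_join : ∀ x y, toFun (BiAlg.join n x y) = BiAlg.join n (toFun x) (toFun y)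
  map_neg : ∀ x, toFun (BiAlg.neg n x) = BiAlg.neg n (toFun x)
  map_const : ∀ c : J n, toFun (BiAlg.const c) = BiAlg.const c

instance (n : ℕ) (A : Type u) (B : Type v) [BiAlg n A] [BiAlg n B] :
    CoeFun (Hom n A B) (fun _ => A → B) := ⟨Hom.toFun⟩

/-- Composition of homomorphisms. -/
def Hom.comp {n : ℕ} {A : Type u} {B : Type v} {C : Type w} [BiAlg n A] [BiAlg n B] [BiAlg n C]
    (h : Hom n B C) (x : Hom n A B) : Hom n A C where
  toFun a := h (x a)
  map_otimes a b := by rw [x.map_otimes, h.map_otimes]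
  map_oplus a b := by rw [x.map_oplus, h.map_oplus]
  map_meet a b := by rw [x.map_meet, h.map_meet]
  map_join a b := by rw [x.map_join, h.map_join]
  map_neg a := by rw [x.map_neg, h.map_neg]
  map_const c := by rw [x.map_const, h.map_const]

/-- Subuniverses (automatically non-empty, because of the constants). -/
@[ext]
structure Subuniverse (n : ℕ) (A : Type u) [BiAlg n A] where
  carrier : Set A
  otimes_mem : ∀ x ∈ carrier, ∀ y ∈ carrier, BiAlg.otimes n x y ∈ carrier
  oplus_mem : ∀ x ∈ carrier, ∀ y ∈ carrier, BiAlg.oplus n x y ∈ carrier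
  meet_mem : ∀ x ∈ carrier, ∀ y ∈ carrier, BiAlg.meet n x y ∈ carrier
  join_mem : ∀ x ∈ carrier, ∀ y ∈ carrier, BiAlg.join n x y ∈ carrier
  neg_mem : ∀ x ∈ carrier, BiAlg.neg n x ∈ carrier
  const_mem : ∀ c : J n, BiAlg.const c ∈ carrier

/-- The subalgebra with a given subuniverse. -/
instance (n : ℕ) (A : Type u) [BiAlg n A] (S : Subuniverse n A) : BiAlg n S.carrier where
  otimes x y := ⟨BiAlg.otimes n x.1 y.1, S.otimes_mem _ x.2 _ y.2⟩
  oplus x y := ⟨BiAlg.oplus n x.1 y.1, S.oplus_mem _ x.2 _ y.2⟩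
  meet x y := ⟨BiAlg.meet n x.1 y.1, S.meet_mem _ x.2 _ y.2⟩
  join x y := ⟨BiAlg.join n x.1 y.1, S.join_mem _ x.2 _ y.2⟩
  neg x := ⟨BiAlg.neg n x.1, S.neg_mem _ x.2⟩
  const c := ⟨BiAlg.const c, S.const_mem c⟩

/-- Membership in the variety `𝒱_n = HSP(𝐉_n)` generated by `𝐉_n`: the algebra is a homomorphic image
of a subalgebra of a power of `𝐉_n`. -/
def InVariety (n : ℕ) (A : Type u) [BiAlg n A] : Prop :=
  ∃ (I : Type u) (S : Subuniverse n (I → J n)) (φ : Hom n S.carrier A), Function.Surjective φ.toFun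

/-! ### The algebras `𝐌_0, …, 𝐌_n` -/

/-- The bilattice reduct of `𝐌_k` is that of `𝐉_0` if `k = 0`, and that of `𝐉_1` otherwise. -/
def level {n : ℕ} : Fin (n + 1) → ℕ
  | ⟨0, _⟩ => 0
  | ⟨_ + 1, _⟩ => 1

/-- The underlying set of `𝐌_k`. For `k ≠ 0` the elements `𝟎, 𝐟, 𝟏, 𝐭` of `M_k` are
`J.f 0`, `J.f 1`, `J.t 0`, `J.t 1`; the elements `𝐟, 𝐭` of `M_0` are `J.f 0`, `J.t 0`. -/
def M (n : ℕ) (k : Fin (n + 1)) : Type := J (level k)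

/-- The values in `𝐌_k` of the constants: `f_i` is sent to `𝟎` if `i < k` and to `𝐟` if `k ≤ i`,
and `t_i` is sent to `𝟏` if `i < k` and to `𝐭` if `k ≤ i`. -/
def constM (n : ℕ) (k : Fin (n + 1)) : J n → J (level k)
  | J.top => J.top
  | J.f i => if i < k then J.f 0 else J.f (Fin.last _)
  | J.t i => if i < k then J.t 0 else J.t (Fin.last _)
  | J.bot => J.bot

/-- The algebra `𝐌_k`. -/
instance (n : ℕ) (k : Fin (n + 1)) : BiAlg n (M n k) where
  otimes := J.otimes (m := level k)
  oplus := J.oplus (m := level k)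
  meet := J.meet (m := level k)
  join := J.join (m := level k)
  neg := J.neg (m := level k)
  const := constM n k

/-- Each sort carries the discrete topology. -/
instance (n : ℕ) (k : Fin (n + 1)) : TopologicalSpace (M n k) := ⊥

instance (n : ℕ) (k : Fin (n + 1)) : DiscreteTopology (M n k) := ⟨rfl⟩

/-! ### Multi-sorted alter egos and the dualities they yield -/

/-- A multi-sorted alter ego of `{𝐌_0, …, 𝐌_n}`: a set of homomorphisms between the sorts and a set of
compatible binary relations between the sorts, each tagged with its source and target sorts
(the topology is discrete). -/
structure AlterEgo (n : ℕ) where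
  G : Set (Σ j k : Fin (n + 1), Hom n (M n j) (M n k))
  R : Set (Σ j k : Fin (n + 1), Subuniverse n (M n j × M n k))

/-- The alter ego with one of its operations removed. -/
def AlterEgo.eraseOp {n : ℕ} (𝔐 : AlterEgo n)
    (g : Σ j k : Fin (n + 1), Hom n (M n j) (M n k)) : AlterEgo n where
  G := 𝔐.G \ {g}
  R := 𝔐.R

/-- The alter ego with one of its relations removed. -/
def AlterEgo.eraseRel {n : ℕ} (𝔐 : AlterEgo n)
    (r : Σ j k : Fin (n + 1), Subuniverse n (M n j × M n k)) : AlterEgo n where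
  G := 𝔐.G
  R := 𝔐.R \ {r}

/-- Multi-sorted topological structures in the signature of an alter ego. -/
structure MStruct {n : ℕ} (𝔐 : AlterEgo n) where
  X : Fin (n + 1) → Type u
  [top : ∀ k, TopologicalSpace (X k)]
  op : ∀ g : 𝔐.G, X g.1.1 → X g.1.2.1
  rel : ∀ r : 𝔐.R, X r.1.1 → X r.1.2.1 → Prop

attribute [instance] MStruct.top

/-- Morphisms: sort-preserving continuous maps that preserve the operations and relations. -/
@[ext]
structure Morphism {n : ℕ} {𝔐 : AlterEgo n} (𝕏 : MStruct.{u} 𝔐) (𝕐 : MStruct.{v} 𝔐) where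
  toFun : ∀ k, 𝕏.X k → 𝕐.X k
  continuous_toFun : ∀ k, Continuous (toFun k)
  map_op : ∀ (g : 𝔐.G) (x : 𝕏.X g.1.1), toFun _ (𝕏.op g x) = 𝕐.op g (toFun _ x)
  map_rel : ∀ (r : 𝔐.R) (x : 𝕏.X r.1.1) (y : 𝕏.X r.1.2.1),
    𝕏.rel r x y → 𝕐.rel r (toFun _ x) (toFun _ y)

/-- The alter ego regarded as a multi-sorted topological structure. -/
def AlterEgo.toMStruct {n : ℕ} (𝔐 : AlterEgo n) : MStruct.{0} 𝔐 where
  X := M n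
  op g := g.1.2.2.toFun
  rel r x y := (x, y) ∈ r.1.2.2.carrier

/-- The dual `D(𝐀)`: its `k`-th sort is the set of homomorphisms from `𝐀` to `𝐌_k`, with topology and
structure inherited from the power of the alter ego indexed by `A`. -/
def dualD {n : ℕ} (𝔐 : AlterEgo n) (A : Type u) [BiAlg n A] : MStruct.{u} 𝔐 where
  X k := Hom n A (M n k)
  top k := TopologicalSpace.induced (fun x : Hom n A (M n k) => x.toFun) Pi.topologicalSpace
  op g x := g.1.2.2.comp x
  rel r x y := ∀ a, (x a, y a) ∈ r.1.2.2.carrier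

/-- The dual `E(𝕏)`: the set of all morphisms from `𝕏` to the alter ego. -/
def dualE {n : ℕ} (𝔐 : AlterEgo n) (𝕏 : MStruct.{u} 𝔐) : Type u := Morphism 𝕏 𝔐.toMStruct

/-- `E(𝕏)` is an algebra, with pointwise operations. -/
instance {n : ℕ} (𝔐 : AlterEgo n) (𝕏 : MStruct.{u} 𝔐) : BiAlg n (dualE 𝔐 𝕏) where
  otimes α β :=
    { toFun := fun k x => BiAlg.otimes n (A := M n k) (α.toFun k x) (β.toFun k x)
      continuous_toFun := fun k =>
        (continuous_of_discreteTopology (f := fun p : M n k × M n k => BiAlg.otimes n p.1 p.2)).comp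
          ((α.continuous_toFun k).prodMk (β.continuous_toFun k))
      map_op := fun g x => by
        rw [α.map_op, β.map_op]; exact (g.1.2.2.map_otimes _ _).symm
      map_rel := fun r x y h => r.1.2.2.otimes_mem _ (α.map_rel r x y h) _ (β.map_rel r x y h) }
  oplus α β :=
    { toFun := fun k x => BiAlg.oplus n (A := M n k) (α.toFun k x) (β.toFun k x)
      continuous_toFun := fun k =>
        (continuous_of_discreteTopology (f := fun p : M n k × M n k => BiAlg.oplus n p.1 p.2)).comp
          ((α.continuous_toFun k).prodMk (β.continuous_toFun k))
      map_op := fun g x => by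
        rw [α.map_op, β.map_op]; exact (g.1.2.2.map_oplus _ _).symm
      map_rel := fun r x y h => r.1.2.2.oplus_mem _ (α.map_rel r x y h) _ (β.map_rel r x y h) }
  meet α β :=
    { toFun := fun k x => BiAlg.meet n (A := M n k) (α.toFun k x) (β.toFun k x)
      continuous_toFun := fun k =>
        (continuous_of_discreteTopology (f := fun p : M n k × M n k => BiAlg.meet n p.1 p.2)).comp
          ((α.continuous_toFun k).prodMk (β.continuous_toFun k))
      map_op := fun g x => by
        rw [α.map_op, β.map_op]; exact (g.1.2.2.map_meet _ _).symm
      map_rel := fun r x y h => r.1.2.2.meet_mem _ (α.map_rel r x y h) _ (β.map_rel r x y h) }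
  join α β :=
    { toFun := fun k x => BiAlg.join n (A := M n k) (α.toFun k x) (β.toFun k x)
      continuous_toFun := fun k =>
        (continuous_of_discreteTopology (f := fun p : M n k × M n k => BiAlg.join n p.1 p.2)).comp
          ((α.continuous_toFun k).prodMk (β.continuous_toFun k))
      map_op := fun g x => by
        rw [α.map_op, β.map_op]; exact (g.1.2.2.map_join _ _).symm
      map_rel := fun r x y h => r.1.2.2.join_mem _ (α.map_rel r x y h) _ (β.map_rel r x y h) }
  neg α :=
    { toFun := fun k x => BiAlg.neg n (A := M n k) (α.toFun k x)
      continuous_toFun := fun k =>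
        (continuous_of_discreteTopology (f := fun p : M n k => BiAlg.neg n p)).comp
          (α.continuous_toFun k)
      map_op := fun g x => by
        rw [α.map_op]; exact (g.1.2.2.map_neg _).symm
      map_rel := fun r x y h => r.1.2.2.neg_mem _ (α.map_rel r x y h) }
  const c :=
    { toFun := fun k _ => BiAlg.const (A := M n k) c
      continuous_toFun := fun _ => continuous_const
      map_op := fun g _ => (g.1.2.2.map_const c).symm
      map_rel := fun r _ _ _ => r.1.2.2.const_mem c }

/-- The evaluation homomorphism `e_𝐀 : 𝐀 → ED(𝐀)`, `e_𝐀(a)(x) = x(a)`. -/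
def evalHom {n : ℕ} (𝔐 : AlterEgo n) (A : Type u) [BiAlg n A] :
    Hom n A (dualE 𝔐 (dualD 𝔐 A)) where
  toFun a :=
    { toFun := fun _ x => x.toFun a
      continuous_toFun := fun _ => (continuous_apply a).comp continuous_induced_dom
      map_op := fun _ _ => rfl
      map_rel := fun _ _ _ h => h a }
  map_otimes a b := Morphism.ext (funext fun _ => funext fun x => x.map_otimes a b)
  map_oplus a b := Morphism.ext (funext fun _ => funext fun x => x.map_oplus a b)
  map_meet a b := Morphism.ext (funext fun _ => funext fun x => x.map_meet a b)
  map_join a b := Morphism.ext (funext fun _ => funext fun x => x.map_join a b)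
  map_neg a := Morphism.ext (funext fun _ => funext fun x => x.map_neg a)
  map_const c := Morphism.ext (funext fun _ => funext fun x => x.map_const c)

/-- The alter ego yields a (multi-sorted) duality on `𝒱_n`: for every algebra `𝐀` in `𝒱_n`, the
homomorphism `e_𝐀` is an isomorphism, that is, a bijective homomorphism. -/
def AlterEgo.YieldsDuality {n : ℕ} (𝔐 : AlterEgo n) : Prop :=
  ∀ (A : Type u) [BiAlg n A], InVariety n A → Function.Bijective (evalHom 𝔐 A).toFun

/-- The alter ego yields an optimal duality on `𝒱_n`: it yields a duality on `𝒱_n`, and none of its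
operations and relations can be removed without destroying the duality. -/
def AlterEgo.YieldsOptimalDuality {n : ℕ} (𝔐 : AlterEgo n) : Prop :=
  AlterEgo.YieldsDuality.{u} 𝔐 ∧
    (∀ g ∈ 𝔐.G, ¬ AlterEgo.YieldsDuality.{u} (𝔐.eraseOp g)) ∧
    (∀ r ∈ 𝔐.R, ¬ AlterEgo.YieldsDuality.{u} (𝔐.eraseRel r))

/-! ### The alter ego `M̃_n` -/

/-- The map sending `𝐟, 𝟎` to `𝐟` and `𝐭, 𝟏` to `𝐭`. -/
def collapse : J 1 → J 0
  | J.top => J.top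
  | J.f _ => J.f 0
  | J.t _ => J.t 0
  | J.bot => J.bot

/-- The homomorphism `g_{k+1} : 𝐌_{k+1} → 𝐌_0`, for `0 ≤ k < n`. -/
def gMap (n : ℕ) (k : Fin n) : Hom n (M n k.succ) (M n 0) where
  toFun := collapse
  map_otimes := show ∀ x y : J 1, collapse (J.otimes x y) = J.otimes (collapse x) (collapse y) by
    decide
  map_oplus := show ∀ x y : J 1, collapse (J.oplus x y) = J.oplus (collapse x) (collapse y) by
    decide
  map_meet := show ∀ x y : J 1, collapse (J.meet x y) = J.meet (collapse x) (collapse y) by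
    decide
  map_join := show ∀ x y : J 1, collapse (J.join x y) = J.join (collapse x) (collapse y) by
    decide
  map_neg := show ∀ x : J 1, collapse (J.neg x) = J.neg (collapse x) by decide
  map_const := by
    show ∀ c : J n, collapse (constM n k.succ c) = constM n 0 c
    rintro (_ | i | i | _)
    · rfl
    · by_cases h : i < k.succ <;> simp [constM, h, collapse] <;> rfl
    · by_cases h : i < k.succ <;> simp [constM, h, collapse] <;> rfl
    · rfl

/-- The set `(M_0 × {⊤}) ∪ ({⊥} × M_0) ∪ {(𝐟, 𝐟), (𝐭, 𝐭)}`. -/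
def leFour : Finset (J 0 × J 0) :=
  (Finset.univ ×ˢ {J.top}) ∪ ({J.bot} ×ˢ Finset.univ) ∪ {(J.f 0, J.f 0), (J.t 0, J.t 0)}

/-- The set `{(⊤,⊤), (⊥,⊥), (𝐟,𝐟), (𝐟,𝟎), (𝟎,𝟎), (𝐭,𝐭), (𝐭,𝟏), (𝟏,𝟏)}`. -/
def leSix : Finset (J 1 × J 1) :=
  {(J.top, J.top), (J.bot, J.bot),
    (J.f 1, J.f 1), (J.f 1, J.f 0), (J.f 0, J.f 0),
    (J.t 1, J.t 1), (J.t 1, J.t 0), (J.t 0, J.t 0)}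

/-- The relation `≤^0` on `𝐌_0`. -/
def leZero (n : ℕ) : Subuniverse n (M n 0 × M n 0) where
  carrier := {p | p ∈ leFour}
  otimes_mem := show ∀ x ∈ leFour, ∀ y ∈ leFour,
    (J.otimes x.1 y.1, J.otimes x.2 y.2) ∈ leFour by decide
  oplus_mem := show ∀ x ∈ leFour, ∀ y ∈ leFour,
    (J.oplus x.1 y.1, J.oplus x.2 y.2) ∈ leFour by decide
  meet_mem := show ∀ x ∈ leFour, ∀ y ∈ leFour,
    (J.meet x.1 y.1, J.meet x.2 y.2) ∈ leFour by decide
  join_mem := show ∀ x ∈ leFour, ∀ y ∈ leFour,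
    (J.join x.1 y.1, J.join x.2 y.2) ∈ leFour by decide
  neg_mem := show ∀ x ∈ leFour, (J.neg x.1, J.neg x.2) ∈ leFour by decide
  const_mem c := (show ∀ x : J 0, (x, x) ∈ leFour by decide) (constM n 0 c)

/-- The relation from `𝐌_{j+1}` to `𝐌_{k+1}` with underlying set `leSix`, for `0 ≤ j ≤ k < n`.
This is `≤^{k+1}` if `j = k`, and `≤^{j+1,k+1}` if `j < k`. -/
def leSucc (n : ℕ) (j k : Fin n) (hjk : j ≤ k) : Subuniverse n (M n j.succ × M n k.succ) where
  carrier := {p | p ∈ leSix}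
  otimes_mem := show ∀ x ∈ leSix, ∀ y ∈ leSix,
    (J.otimes x.1 y.1, J.otimes x.2 y.2) ∈ leSix by decide
  oplus_mem := show ∀ x ∈ leSix, ∀ y ∈ leSix,
    (J.oplus x.1 y.1, J.oplus x.2 y.2) ∈ leSix by decide
  meet_mem := show ∀ x ∈ leSix, ∀ y ∈ leSix,
    (J.meet x.1 y.1, J.meet x.2 y.2) ∈ leSix by decide
  join_mem := show ∀ x ∈ leSix, ∀ y ∈ leSix,
    (J.join x.1 y.1, J.join x.2 y.2) ∈ leSix by decide
  neg_mem := show ∀ x ∈ leSix, (J.neg x.1, J.neg x.2) ∈ leSix by decide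
  const_mem := by
    show ∀ c : J n, ((constM n j.succ c, constM n k.succ c) : J 1 × J 1) ∈ leSix
    have hjk' : j.succ ≤ k.succ := Fin.succ_le_succ_iff.mpr hjk
    rintro (_ | i | i | _)
    · exact (by decide : ((J.top, J.top) : J 1 × J 1) ∈ leSix)
    · by_cases h : i < j.succ
      · have h' : i < k.succ := lt_of_lt_of_le h hjk'
        simp only [constM, h, h', if_true]
        exact (by decide : ((J.f 0, J.f 0) : J 1 × J 1) ∈ leSix)
      · by_cases h' : i < k.succ <;> simp only [constM, h, h', if_true, if_false]
        · exact (by decide : ((J.f 1, J.f 0) : J 1 × J 1) ∈ leSix)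
        · exact (by decide : ((J.f 1, J.f 1) : J 1 × J 1) ∈ leSix)
    · by_cases h : i < j.succ
      · have h' : i < k.succ := lt_of_lt_of_le h hjk'
        simp only [constM, h, h', if_true]
        exact (by decide : ((J.t 0, J.t 0) : J 1 × J 1) ∈ leSix)
      · by_cases h' : i < k.succ <;> simp only [constM, h, h', if_true, if_false]
        · exact (by decide : ((J.t 1, J.t 0) : J 1 × J 1) ∈ leSix)
        · exact (by decide : ((J.t 1, J.t 1) : J 1 × J 1) ∈ leSix)
    · exact (by decide : ((J.bot, J.bot) : J 1 × J 1) ∈ leSix)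

/-- The alter ego `M̃_n`, with operations `g_k` (`1 ≤ k ≤ n`) and relations `≤^k` (`0 ≤ k ≤ n`) and
`≤^{jk}` (`1 ≤ j < k ≤ n`). -/
def alterEgo (n : ℕ) : AlterEgo n where
  G := {g | ∃ k : Fin n, g = ⟨k.succ, 0, gMap n k⟩}
  R := {r | r = ⟨0, 0, leZero n⟩ ∨
    (∃ k : Fin n, r = ⟨k.succ, k.succ, leSucc n k k le_rfl⟩) ∨
    (∃ (j k : Fin n) (h : j < k), r = ⟨j.succ, k.succ, leSucc n j k h.le⟩)}

end BilatticeDuality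

namespace BilatticeDuality

/-! ### Truth-prime filters given by homomorphisms -/

/-! Everything is read off the truth lattice, which is bounded and distributive on every algebra of
the variety. The truth lattice of 𝐌_0 has the two prime filters {𝐭, ⊤} and {𝐭, ⊥}. That of 𝐌_k, k ≥
1, has four: {𝟏}, M_k \ {𝟎}, and the preimages of the former two under g_k. A point of the dual
together with one of the filters of its sort therefore gives a truth-prime filter of 𝐀.

Surjectivity of evaluation. A morphism α assigns a Boolean to each point. Preservation of the g_k
and of the relations yields, for any two points where α takes the values true and false, an element
of 𝐀 that does the same (`Morphism.exists_val`). The space of points is compact, so finite meets and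
joins of such elements produce one element that agrees with α everywhere (`exists_val_eq`). No
membership in the variety is needed here.

Injectivity. In a subalgebra 𝐒 of a power of 𝐉_n the quotient maps 𝐉_n → 𝐌_k make the points
determine the truth order, and by compactness every truth-prime filter of 𝐒 comes from a point
(`exists_val_eq_prime`). If 𝐀 is a quotient of 𝐒, a prime filter of 𝐀 that separates two elements
pulls back to a filter of 𝐒, hence to a point of 𝐒. That point descends to 𝐀 because unary terms
recover the homomorphism from its filter (`Pt.exists_desc`).

Optimality. Each relation is itself an algebra of the variety. Its projections are points of the
dual that only the relation itself ties together: the constants show that sorts unrelated to it are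
empty. A map defined through one element of this algebra then preserves all the remaining structure
without being an evaluation (`AlterEgo.not_yieldsDuality`). -/

/-- The indicator functions of the prime filters `{𝐭, ⊤}` and `{𝐭, ⊥}` of the truth lattice of `𝐌_0`. -/
def fourMem : J 0 → Bool → Bool
  | J.top, b => b
  | J.f _, _ => false
  | J.t _, _ => true
  | J.bot, b => !b

/-- The indicator functions of the prime filters `{𝟏}` and `M_k \ {𝟎}` of the truth lattice of `𝐌_k`,
`k ≥ 1`. -/
def sixMem : J 1 → Bool → Bool
  | J.t 0, _ => true
  | J.f 0, _ => false
  | _, b => !b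

/-- A point of the dual of `A`, together with a prime filter of the truth lattice of its sort. -/
abbrev Pt (n : ℕ) (A : Type u) [BiAlg n A] : Type u :=
  ((Σ k : Fin n, Hom n A (M n k.succ)) ⊕ Hom n A (M n 0)) × Bool

/-- The indicator function of the truth-prime filter of `A` determined by a point. -/
def val {n : ℕ} {A : Type u} [BiAlg n A] : Pt n A → A → Bool
  | (Sum.inl x, b), a => sixMem (x.2 a) b
  | (Sum.inr z, b), a => fourMem (z a) b

section val

variable {n : ℕ} {A : Type u} [BiAlg n A]

theorem val_meet (p : Pt n A) (a b : A) : val p (BiAlg.meet n a b) = (val p a && val p b) := by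
  obtain ⟨x | z, c⟩ := p
  · exact (congrArg (sixMem · c) (x.2.map_meet a b)).trans
      ((by decide : ∀ (u v : J 1) c, sixMem (J.meet u v) c = (sixMem u c && sixMem v c)) _ _ _)
  · exact (congrArg (fourMem · c) (z.map_meet a b)).trans
      ((by decide : ∀ (u v : J 0) c, fourMem (J.meet u v) c = (fourMem u c && fourMem v c)) _ _ _)

theorem val_join (p : Pt n A) (a b : A) : val p (BiAlg.join n a b) = (val p a || val p b) := by
  obtain ⟨x | z, c⟩ := p
  · exact (congrArg (sixMem · c) (x.2.map_join a b)).trans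
      ((by decide : ∀ (u v : J 1) c, sixMem (J.join u v) c = (sixMem u c || sixMem v c)) _ _ _)
  · exact (congrArg (fourMem · c) (z.map_join a b)).trans
      ((by decide : ∀ (u v : J 0) c, fourMem (J.join u v) c = (fourMem u c || fourMem v c)) _ _ _)

theorem constM_zero_t (i : Fin (n + 1)) : constM n 0 (J.t i) = (J.t 0 : J 0) := by
  simp [constM]; rfl

theorem constM_zero_f (i : Fin (n + 1)) : constM n 0 (J.f i) = (J.f 0 : J 0) := by
  simp [constM]; rfl

theorem val_t_zero (p : Pt n A) : val p (BiAlg.const (J.t 0 : J n)) = true := by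
  obtain ⟨x | z, c⟩ := p
  · exact (congrArg (sixMem · c) (x.2.map_const (J.t 0))).trans rfl
  · exact (congrArg (fourMem · c) ((z.map_const (J.t 0)).trans (constM_zero_t 0))).trans rfl

theorem val_f_zero (p : Pt n A) : val p (BiAlg.const (J.f 0 : J n)) = false := by
  obtain ⟨x | z, c⟩ := p
  · exact (congrArg (sixMem · c) (x.2.map_const (J.f 0))).trans rfl
  · exact (congrArg (fourMem · c) ((z.map_const (J.f 0)).trans (constM_zero_f 0))).trans rfl

end val

/-! ### Compactness of the dual -/

section compact

variable {n : ℕ} {A : Type u} [BiAlg n A]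

instance (k : Fin (n + 1)) : TopologicalSpace (Hom n A (M n k)) :=
  TopologicalSpace.induced (fun x : Hom n A (M n k) => x.toFun) Pi.topologicalSpace

instance (k : Fin (n + 1)) : Finite (M n k) := inferInstanceAs (Finite (J (level k)))

theorem Hom.continuous_eval (k : Fin (n + 1)) (a : A) :
    Continuous fun x : Hom n A (M n k) => x a :=
  (continuous_apply a).comp continuous_induced_dom

/-- Each homomorphism condition involves only finitely many coordinates of the power, so it is
closed. The dual is then a closed subspace of a power of a finite discrete space, hence compact. -/
theorem Hom.isClosed_range (k : Fin (n + 1)) :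
    IsClosed (Set.range fun x : Hom n A (M n k) => x.toFun) := by
  have hop (o : M n k → M n k → M n k) (o' : A → A → A) :
      IsClosed {f : A → M n k | ∀ a b, f (o' a b) = o (f a) (f b)} := by
    simp only [Set.ofPred_forall]
    refine isClosed_iInter fun a => isClosed_iInter fun b => isClosed_eq (continuous_apply _) ?_
    exact (continuous_of_discreteTopology (f := fun p : M n k × M n k => o p.1 p.2)).comp
      (show Continuous fun f : A → M n k => (f a, f b) from
        (continuous_apply a).prodMk (continuous_apply b))
  have hneg : IsClosed {f : A → M n k | ∀ a, f (BiAlg.neg n a) = BiAlg.neg n (f a)} := by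
    simp only [Set.ofPred_forall]
    refine isClosed_iInter fun a => isClosed_eq (continuous_apply _) ?_
    exact (continuous_of_discreteTopology (f := fun p : M n k => BiAlg.neg n p)).comp
      (continuous_apply a)
  have hconst : IsClosed {f : A → M n k | ∀ c : J n, f (BiAlg.const c) = BiAlg.const c} := by
    simp only [Set.ofPred_forall]
    exact isClosed_iInter fun a => isClosed_eq (continuous_apply _) continuous_const
  convert (hop (BiAlg.otimes n) (BiAlg.otimes n)).inter <| (hop (BiAlg.oplus n) (BiAlg.oplus n)).inter <|
    (hop (BiAlg.meet n) (BiAlg.meet n)).inter <| (hop (BiAlg.join n) (BiAlg.join n)).inter <|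
    hneg.inter hconst using 1
  ext f
  constructor
  · rintro ⟨x, rfl⟩
    exact ⟨x.map_otimes, x.map_oplus, x.map_meet, x.map_join, x.map_neg, x.map_const⟩
  · rintro ⟨h1, h2, h3, h4, h5, h6⟩
    exact ⟨⟨f, h1, h2, h3, h4, h5, h6⟩, rfl⟩

instance (k : Fin (n + 1)) : CompactSpace (Hom n A (M n k)) :=
  Topology.IsClosedEmbedding.compactSpace (f := fun x : Hom n A (M n k) => x.toFun)
    ⟨⟨⟨rfl⟩, fun _ _ h => Hom.ext h⟩, Hom.isClosed_range k⟩

theorem continuous_val (a : A) : Continuous fun p : Pt n A => val p a := by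
  have h1 : Continuous fun p : (Σ k : Fin n, Hom n A (M n k.succ)) × Bool =>
      sixMem (p.1.2 a) p.2 := by
    rw [continuous_prod_of_discrete_right]
    intro b
    rw [continuous_sigma_iff]
    intro k
    exact (continuous_of_discreteTopology (f := fun u : M n k.succ => sixMem u b)).comp
      (Hom.continuous_eval k.succ a)
  have h2 : Continuous fun p : Hom n A (M n 0) × Bool => fourMem (p.1 a) p.2 := by
    rw [continuous_prod_of_discrete_right]
    intro b
    exact (continuous_of_discreteTopology (f := fun u : M n 0 => fourMem u b)).comp
      (Hom.continuous_eval 0 a)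
  rw [continuous_prod_of_discrete_right] at h1 h2 ⊢
  intro b
  rw [continuous_sum_dom]
  exact ⟨h1 b, h2 b⟩

/-- A continuous two-valued function on the points that can be interpolated at any two points by an
element of `A` is given by an element of `A`. -/
theorem exists_val_eq (ψ : Pt n A → Bool) (hψ : Continuous ψ)
    (hsep : ∀ p q, ψ p = true → ψ q = false → ∃ a, val p a = true ∧ val q a = false) :
    ∃ a, ∀ p, val p a = ψ p := by
  have hopen (a : A) (b : Bool) : IsOpen {p : Pt n A | val p a = b} :=
    (isOpen_discrete {b}).preimage (continuous_val a)
  have hcl (b : Bool) : IsCompact {p : Pt n A | ψ p = b} :=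
    ((isClosed_discrete {b}).preimage hψ).isCompact
  -- Fix a point where `ψ` is true and cover the compact set where `ψ` is false; finite meets
  -- combine the local interpolants. The next step covers the set where `ψ` is true and combines by
  -- finite joins.
  have h1 (p : Pt n A) (hp : ψ p = true) :
      ∃ a, val p a = true ∧ ∀ q ∈ {q | ψ q = false}, val q a = false := by
    refine (hcl false).induction_on (p := fun s => ∃ a, val p a = true ∧ ∀ q ∈ s, val q a = false)
      ⟨_, val_t_zero p, by simp⟩ (fun s t hst ⟨a, ha, h⟩ => ⟨a, ha, fun q hq => h q (hst hq)⟩) ?_ ?_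
    · rintro s t ⟨a, ha, has⟩ ⟨b, hb, hbt⟩
      refine ⟨BiAlg.meet n a b, by simp [val_meet, ha, hb], ?_⟩
      rintro q (hq | hq)
      · simp [val_meet, has q hq]
      · simp [val_meet, hbt q hq]
    · intro q hq
      obtain ⟨a, hpa, hqa⟩ := hsep p q hp hq
      exact ⟨_, mem_nhdsWithin_of_mem_nhds ((hopen a false).mem_nhds hqa), a, hpa, fun _ h => h⟩
  have h2 : ∃ a, (∀ q, ψ q = false → val q a = false) ∧ ∀ p ∈ {p | ψ p = true}, val p a = true := by
    refine (hcl true).induction_on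
      (p := fun s => ∃ a, (∀ q, ψ q = false → val q a = false) ∧ ∀ p ∈ s, val p a = true)
      ⟨_, fun q _ => val_f_zero q, by simp⟩
      (fun s t hst ⟨a, ha, h⟩ => ⟨a, ha, fun q hq => h q (hst hq)⟩) ?_ ?_
    · rintro s t ⟨a, ha, has⟩ ⟨b, hb, hbt⟩
      refine ⟨BiAlg.join n a b, fun q hq => by simp [val_join, ha q hq, hb q hq], ?_⟩
      rintro q (hq | hq)
      · simp [val_join, has q hq]
      · simp [val_join, hbt q hq]
    · intro p hp
      obtain ⟨a, hpa, hqa⟩ := h1 p hp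
      exact ⟨_, mem_nhdsWithin_of_mem_nhds ((hopen a true).mem_nhds hpa), a, hqa, fun _ h => h⟩
  obtain ⟨a, ha, ha'⟩ := h2
  refine ⟨a, fun p => ?_⟩
  cases h : ψ p
  · exact ha p h
  · exact ha' p h

/-- If the points of `A` separate the elements of its truth lattice, then they exhaust its prime
filters. -/
theorem exists_val_eq_prime
    (hsep : ∀ a b : A, (∀ p : Pt n A, val p a = true → val p b = true) → BiAlg.meet n a b = a)
    (v : A → Bool) (hmeet : ∀ a b, v (BiAlg.meet n a b) = (v a && v b))
    (hjoin : ∀ a b, v (BiAlg.join n a b) = (v a || v b))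
    (ht : v (BiAlg.const (J.t 0 : J n)) = true) (hf : v (BiAlg.const (J.f 0 : J n)) = false) :
    ∃ p : Pt n A, ∀ a, val p a = v a := by
  -- If every point disagrees with `v` somewhere, compactness merges the finitely many disagreements
  -- into `a`, `b` with `v a` true and `v b` false, while no point separates `a` from `b`. Then `a`
  -- lies below `b`, against `v`.
  by_contra! hne
  have hopen (a : A) (b : Bool) : IsOpen {p : Pt n A | val p a = b} :=
    (isOpen_discrete {b}).preimage (continuous_val a)
  obtain ⟨a, b, ha, hb, h⟩ : ∃ a b, v a = true ∧ v b = false ∧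
      ∀ p ∈ (Set.univ : Set (Pt n A)), val p a = true → val p b = true := by
    refine isCompact_univ.induction_on (p := fun s => ∃ a b, v a = true ∧ v b = false ∧
      ∀ p ∈ s, val p a = true → val p b = true) ⟨_, _, ht, hf, by simp⟩
      (fun s t hst ⟨a, b, ha, hb, h⟩ => ⟨a, b, ha, hb, fun q hq => h q (hst hq)⟩) ?_ ?_
    · rintro s t ⟨a, b, ha, hb, h⟩ ⟨a', b', ha', hb', h'⟩
      refine ⟨BiAlg.meet n a a', BiAlg.join n b b', by simp [hmeet, ha, ha'],
        by simp [hjoin, hb, hb'], ?_⟩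
      simp only [val_meet, val_join, Bool.and_eq_true, Bool.or_eq_true]
      rintro p (hp | hp) ⟨h1, h2⟩
      · exact Or.inl (h p hp h1)
      · exact Or.inr (h' p hp h2)
    · intro p _
      obtain ⟨a, ha⟩ := hne p
      refine ⟨_, mem_nhdsWithin_of_mem_nhds ((hopen a _).mem_nhds rfl), ?_⟩
      cases hva : v a
      · exact ⟨_, a, ht, hva, fun q hq _ => by
          rw [hva] at ha
          exact (show val q a = val p a from hq).trans (by simpa using ha)⟩
      · refine ⟨a, _, hva, hf, fun q hq h => ?_⟩
        rw [hva] at ha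
        exact absurd ((show val q a = val p a from hq).symm.trans h) ha
  have := congrArg v (hsep a b fun p => h p trivial)
  simp [hmeet, ha, hb] at this

end compact

/-! ### Two terms -/

section terms

variable (n : ℕ) {A : Type u} [BiAlg n A]

/-- A term that carries the truth filter of `⊤` into the least truth filters. -/
def upTop (a : A) : A :=
  BiAlg.otimes n (BiAlg.meet n (BiAlg.otimes n a (BiAlg.const (J.t 0 : J n)))
    (BiAlg.const (J.top : J n))) (BiAlg.const (J.t 0 : J n))

/-- A term that carries the truth filter of `⊥` into the least truth filters. -/
def upBot (a : A) : A := BiAlg.oplus n a (BiAlg.const (J.t 0 : J n))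

variable {n}

/-- The value of `upTop` in `𝐉_m`. -/
def J.upTop {m : ℕ} (u : J m) : J m := J.otimes (J.meet (J.otimes u (J.t 0)) J.top) (J.t 0)

/-- The value of `upBot` in `𝐉_m`. -/
def J.upBot {m : ℕ} (u : J m) : J m := J.oplus u (J.t 0)

/-- The value of `J.upTop` is `t 0` on ⊤ and on every `t i`, and ⊥ elsewhere; that of `J.upBot` is
`t 0` on ⊥ and on every `t i`, and ⊤ elsewhere. So membership in the preimage of {𝐭, ⊤} or {𝐭, ⊥}
becomes equality with 𝟏. -/
theorem Hom.map_upTop_six {k : Fin n} (x : Hom n A (M n k.succ)) (a : A) :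
    x (upTop n a) = (J.upTop (x a : J 1) : J 1) := by
  simp only [upTop, x.map_otimes, x.map_meet, x.map_const]; rfl

theorem Hom.map_upBot_six {k : Fin n} (x : Hom n A (M n k.succ)) (a : A) :
    x (upBot n a) = (J.upBot (x a : J 1) : J 1) := by
  simp only [upBot, x.map_oplus, x.map_const]; rfl

theorem Hom.map_upTop_four (x : Hom n A (M n 0)) (a : A) :
    x (upTop n a) = (J.upTop (x a : J 0) : J 0) := by
  simp only [upTop, x.map_otimes, x.map_meet, x.map_const]
  have h : (BiAlg.const (J.t 0 : J n) : M n 0) = (J.t 0 : J 0) := constM_zero_t 0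
  rw [h]; rfl

theorem Hom.map_upBot_four (x : Hom n A (M n 0)) (a : A) :
    x (upBot n a) = (J.upBot (x a : J 0) : J 0) := by
  simp only [upBot, x.map_oplus, x.map_const]
  have h : (BiAlg.const (J.t 0 : J n) : M n 0) = (J.t 0 : J 0) := constM_zero_t 0
  rw [h]; rfl

end terms

/-! ### Morphisms from a dual to the alter ego -/

section morphism

variable {n : ℕ} {A : Type u} [BiAlg n A]

theorem leSucc_mem_alterEgo {j k : Fin n} (h : j ≤ k) :
    (⟨j.succ, k.succ, leSucc n j k h⟩ : Σ j k : Fin (n + 1), Subuniverse n (M n j × M n k)) ∈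
      (alterEgo n).R := by
  rcases h.eq_or_lt with rfl | hlt
  · exact Or.inr (Or.inl ⟨j, rfl⟩)
  · exact Or.inr (Or.inr ⟨j, k, hlt, rfl⟩)

variable (α : Morphism (dualD (alterEgo n) A) (alterEgo n).toMStruct)

/-- The values of a morphism on the sort `𝐌_{k+1}`. -/
def Morphism.six {k : Fin n} (x : Hom n A (M n k.succ)) : J 1 := α.toFun k.succ x

/-- The values of a morphism on the sort `𝐌_0`. -/
def Morphism.four (x : Hom n A (M n 0)) : J 0 := α.toFun 0 x

theorem Morphism.four_gMap_comp {k : Fin n} (x : Hom n A (M n k.succ)) :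
    α.four ((gMap n k).comp x) = collapse (α.six x) :=
  α.map_op ⟨⟨k.succ, 0, gMap n k⟩, k, rfl⟩ x

theorem Morphism.four_le {x y : Hom n A (M n 0)} (h : ∀ a, ((x a : J 0), (y a : J 0)) ∈ leFour) :
    (α.four x, α.four y) ∈ leFour :=
  α.map_rel ⟨⟨0, 0, leZero n⟩, Or.inl rfl⟩ x y h

theorem Morphism.six_le {j k : Fin n} (hjk : j ≤ k) {x : Hom n A (M n j.succ)}
    {y : Hom n A (M n k.succ)} (h : ∀ a, ((x a : J 1), (y a : J 1)) ∈ leSix) :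
    (α.six x, α.six y) ∈ leSix :=
  α.map_rel ⟨⟨j.succ, k.succ, leSucc n j k hjk⟩, leSucc_mem_alterEgo hjk⟩ x y h

/-- Truth-order information on a morphism at two points of the sort `𝐌_0`. -/
theorem Morphism.exists_four {x y : Hom n A (M n 0)} {b : Bool}
    (hx : fourMem (α.four x) b = true) (hy : fourMem (α.four y) b = false) :
    ∃ a, fourMem (x a) b = true ∧ fourMem (y a) b = false := by
  -- `leFour` is the knowledge order. The filter {𝐭, ⊤} is an up-set for it and {𝐭, ⊥} a down-set,
  -- which is why the roles of `x` and `y` are exchanged when `b` is false. A failure of the order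
  -- shows on these filters after at most one negation.
  have key : ∀ u v : J 0, (u, v) ∉ leFour →
      (fourMem u true = true ∧ fourMem v true = false ∨
        fourMem (J.neg u) true = true ∧ fourMem (J.neg v) true = false) ∧
      (fourMem v false = true ∧ fourMem u false = false ∨
        fourMem (J.neg v) false = true ∧ fourMem (J.neg u) false = false) := by decide
  cases b
  · have hne : (α.four y, α.four x) ∉ leFour :=
      (by decide : ∀ u v : J 0, fourMem u false = true → fourMem v false = false →
        (v, u) ∉ leFour) _ _ hx hy
    obtain ⟨a, ha⟩ := not_forall.1 (mt α.four_le hne)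
    rcases (key _ _ ha).2 with h | h
    · exact ⟨a, h⟩
    · exact ⟨BiAlg.neg n a, by rw [x.map_neg, y.map_neg]; exact h⟩
  · have hne : (α.four x, α.four y) ∉ leFour :=
      (by decide : ∀ u v : J 0, fourMem u true = true → fourMem v true = false →
        (u, v) ∉ leFour) _ _ hx hy
    obtain ⟨a, ha⟩ := not_forall.1 (mt α.four_le hne)
    rcases (key _ _ ha).1 with h | h
    · exact ⟨a, h⟩
    · exact ⟨BiAlg.neg n a, by rw [x.map_neg, y.map_neg]; exact h⟩

/-- The maps g_k transfer the filters that come from 𝐌_0 to the other sorts, so ≤^0 alone handles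
them. -/
theorem Morphism.exists_collapse_left {k : Fin n} {x : Hom n A (M n k.succ)} {y : Hom n A (M n 0)}
    {b : Bool} (hx : fourMem (collapse (α.six x)) b = true) (hy : fourMem (α.four y) b = false) :
    ∃ a, fourMem (collapse (x a)) b = true ∧ fourMem (y a) b = false :=
  α.exists_four (x := (gMap n k).comp x) (by rwa [α.four_gMap_comp]) hy

theorem Morphism.exists_collapse_right {k : Fin n} {x : Hom n A (M n 0)} {y : Hom n A (M n k.succ)}
    {b : Bool} (hx : fourMem (α.four x) b = true) (hy : fourMem (collapse (α.six y)) b = false) :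
    ∃ a, fourMem (x a) b = true ∧ fourMem (collapse (y a)) b = false :=
  α.exists_four (y := (gMap n k).comp y) hx (by rwa [α.four_gMap_comp])

theorem Morphism.exists_collapse {j k : Fin n} {x : Hom n A (M n j.succ)}
    {y : Hom n A (M n k.succ)} {b : Bool} (hx : fourMem (collapse (α.six x)) b = true)
    (hy : fourMem (collapse (α.six y)) b = false) :
    ∃ a, fourMem (collapse (x a)) b = true ∧ fourMem (collapse (y a)) b = false :=
  α.exists_collapse_left (y := (gMap n k).comp y) hx (by rwa [α.four_gMap_comp])

/-- Truth-order information on homomorphisms that are not related by the alter ego. -/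
theorem Hom.exists_six {j k : Fin n} {x : Hom n A (M n j.succ)} {y : Hom n A (M n k.succ)}
    (h : j ≤ k → ∃ a, ((x a : J 1), (y a : J 1)) ∉ leSix) :
    ∃ a, x a = (J.t 0 : J 1) ∧ y a ≠ (J.t 0 : J 1) := by
  rcases le_or_gt j k with hjk | hkj
  · obtain ⟨a, ha⟩ := h hjk
    -- Six unary terms suffice to turn any unrelated pair into one whose first entry is 𝟏 and whose
    -- second is not.
    have key : ∀ u v : J 1, (u, v) ∉ leSix →
        (u = J.t 0 ∧ v ≠ J.t 0) ∨ (J.neg u = J.t 0 ∧ J.neg v ≠ J.t 0) ∨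
        (J.upTop u = J.t 0 ∧ J.upTop v ≠ J.t 0) ∨
        (J.upTop (J.neg u) = J.t 0 ∧ J.upTop (J.neg v) ≠ J.t 0) ∨
        (J.upBot u = J.t 0 ∧ J.upBot v ≠ J.t 0) ∨
        (J.upBot (J.neg u) = J.t 0 ∧ J.upBot (J.neg v) ≠ J.t 0) := by decide
    rcases key _ _ ha with h | h | h | h | h | h
    · exact ⟨a, h⟩
    · exact ⟨BiAlg.neg n a, by rw [x.map_neg, y.map_neg]; exact h⟩
    · exact ⟨upTop n a, by rw [x.map_upTop_six, y.map_upTop_six]; exact h⟩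
    · exact ⟨upTop n (BiAlg.neg n a), by
        rw [x.map_upTop_six, y.map_upTop_six, x.map_neg, y.map_neg]; exact h⟩
    · exact ⟨upBot n a, by rw [x.map_upBot_six, y.map_upBot_six]; exact h⟩
    · exact ⟨upBot n (BiAlg.neg n a), by
        rw [x.map_upBot_six, y.map_upBot_six, x.map_neg, y.map_neg]; exact h⟩
  -- When the sort of `x` is the larger one a constant already separates: t_i with i the sort of `y`
  -- is 𝟏 in the larger sort and 𝐭 in that of `y`. Hence no relation ≤^{jk} with j > k is needed.
  · refine ⟨BiAlg.const (J.t k.succ : J n), (x.map_const _).trans ?_, fun h => ?_⟩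
    · exact if_pos (Fin.succ_lt_succ_iff.2 hkj)
    · have h' := (y.map_const (J.t k.succ)).symm.trans h
      replace h' : (if k.succ < k.succ then J.t 0 else J.t 1 : J 1) = J.t 0 := h'
      simp at h'

theorem Morphism.exists_six_true {j k : Fin n} {x : Hom n A (M n j.succ)}
    {y : Hom n A (M n k.succ)} (hx : α.six x = J.t 0) (hy : α.six y ≠ J.t 0) :
    ∃ a, x a = (J.t 0 : J 1) ∧ y a ≠ (J.t 0 : J 1) := by
  refine Hom.exists_six fun hjk => not_forall.1 (mt (α.six_le hjk) ?_)
  rw [hx]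
  exact (by decide : ∀ u : J 1, u ≠ J.t 0 → (J.t 0, u) ∉ leSix) _ hy

/-- Negation exchanges 𝟎 with 𝟏 and reverses the roles of the two points, so the relation used goes
from the sort of `y` to that of `x`. -/
theorem Morphism.exists_six_false {j k : Fin n} {x : Hom n A (M n j.succ)}
    {y : Hom n A (M n k.succ)} (hx : α.six x ≠ J.f 0) (hy : α.six y = J.f 0) :
    ∃ a, x a ≠ (J.f 0 : J 1) ∧ y a = (J.f 0 : J 1) := by
  obtain ⟨a, hya, hxa⟩ : ∃ a, y a = (J.t 0 : J 1) ∧ x a ≠ (J.t 0 : J 1) := by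
    refine Hom.exists_six fun hkj => not_forall.1 (mt (α.six_le hkj) ?_)
    rw [hy]
    exact (by decide : ∀ u : J 1, u ≠ J.f 0 → (J.f 0, u) ∉ leSix) _ hx
  refine ⟨BiAlg.neg n a, ?_, ?_⟩
  · rw [x.map_neg]
    exact (by decide : ∀ u : J 1, u ≠ J.t 0 → J.neg u ≠ J.f 0) _ hxa
  · rw [y.map_neg, hya]; rfl

theorem Morphism.exists_six_cross {j k : Fin n} {x : Hom n A (M n j.succ)}
    {y : Hom n A (M n k.succ)} (hx : α.six x = J.t 0) (hy : α.six y = J.f 0) :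
    ∃ a, x a = (J.t 0 : J 1) ∧ y a = (J.f 0 : J 1) := by
  obtain ⟨a, ha⟩ := α.exists_collapse (x := x) (y := y) (b := true) (by rw [hx]; rfl)
    (by rw [hy]; rfl)
  obtain ⟨b, hb⟩ := α.exists_collapse (x := x) (y := y) (b := false) (by rw [hx]; rfl)
    (by rw [hy]; rfl)
  -- Put p = `upTop n a` and q = `upBot n b`. At `x` both are 𝟏, and at `y` they are ⊥ and ⊤. In (p
  -- ∧ q) ⊕ ((p ⊕ 𝟎) ∨ (q ⊗ 𝟎)) the two summands are 𝟏 and 𝐭 at `x`, with sum 𝟏, and 𝐟 and 𝟎 at `y`,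
  -- with sum 𝟎.
  refine ⟨BiAlg.oplus n (BiAlg.meet n (upTop n a) (upBot n b))
    (BiAlg.join n (BiAlg.oplus n (upTop n a) (BiAlg.const (J.f 0 : J n)))
      (BiAlg.otimes n (upBot n b) (BiAlg.const (J.f 0 : J n)))), ?_⟩
  simp only [x.map_oplus, x.map_meet, x.map_join, x.map_otimes, x.map_const, x.map_upTop_six,
    x.map_upBot_six, y.map_oplus, y.map_meet, y.map_join, y.map_otimes, y.map_const,
    y.map_upTop_six, y.map_upBot_six]
  have key1 : ∀ u v u' v' : J 1, fourMem (collapse u) true = true ∧ fourMem (collapse v) true = false →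
    fourMem (collapse u') false = true ∧ fourMem (collapse v') false = false →
    J.upTop u = J.t 0 ∧ J.upTop v = J.bot ∧ J.upBot u' = J.t 0 ∧ J.upBot v' = J.top := by decide
  obtain ⟨h1, h2, h3, h4⟩ := key1 _ _ _ _ ha hb
  rw [h1, h2, h3, h4]
  exact ⟨rfl, rfl⟩

/-- The truth-prime filter indicator of a morphism at a point. -/
def Morphism.val : Pt n A → Bool
  | (Sum.inl x, b) => sixMem (α.six x.2) b
  | (Sum.inr z, b) => fourMem (α.four z) b

theorem Morphism.continuous_val : Continuous α.val := by
  rw [continuous_prod_of_discrete_right]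
  intro b
  rw [continuous_sum_dom, continuous_sigma_iff]
  refine ⟨fun k => ?_, ?_⟩
  · exact (continuous_of_discreteTopology (f := fun u : M n k.succ => sixMem u b)).comp
      (α.continuous_toFun k.succ)
  · exact (continuous_of_discreteTopology (f := fun u : M n 0 => fourMem u b)).comp
      (α.continuous_toFun 0)

/-! ### Filter membership, and the filters evaluated at constants. -/

theorem sixMem_true_iff {u : J 1} : sixMem u true = true ↔ u = J.t 0 := by revert u; decide

theorem sixMem_false_iff {u : J 1} : sixMem u false = false ↔ u = J.f 0 := by revert u; decide

theorem sixMem_true_eq_false_iff {u : J 1} : sixMem u true = false ↔ u ≠ J.t 0 := by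
  revert u; decide

theorem sixMem_false_eq_true_iff {u : J 1} : sixMem u false = true ↔ u ≠ J.f 0 := by
  revert u; decide

theorem constM_t_last (k : Fin n) : constM n k.succ (J.t (Fin.last n)) = (J.t 1 : J 1) :=
  if_neg (Fin.le_last _).not_gt

theorem constM_f_last (k : Fin n) : constM n k.succ (J.f (Fin.last n)) = (J.f 1 : J 1) :=
  if_neg (Fin.le_last _).not_gt

theorem val_t_last_six {k : Fin n} (x : Hom n A (M n k.succ)) (b : Bool) :
    val (Sum.inl ⟨k, x⟩, b) (BiAlg.const (J.t (Fin.last n) : J n)) = !b :=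
  (congrArg (sixMem · b) ((x.map_const _).trans (constM_t_last k))).trans rfl

theorem val_f_last_six {k : Fin n} (x : Hom n A (M n k.succ)) (b : Bool) :
    val (Sum.inl ⟨k, x⟩, b) (BiAlg.const (J.f (Fin.last n) : J n)) = !b :=
  (congrArg (sixMem · b) ((x.map_const _).trans (constM_f_last k))).trans rfl

theorem val_t_last_four (z : Hom n A (M n 0)) (b : Bool) :
    val (Sum.inr z, b) (BiAlg.const (J.t (Fin.last n) : J n)) = true :=
  (congrArg (fourMem · b) ((z.map_const _).trans (constM_zero_t _))).trans rfl

theorem val_f_last_four (z : Hom n A (M n 0)) (b : Bool) :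
    val (Sum.inr z, b) (BiAlg.const (J.f (Fin.last n) : J n)) = false :=
  (congrArg (fourMem · b) ((z.map_const _).trans (constM_zero_f _))).trans rfl

theorem val_top_four (z : Hom n A (M n 0)) (b : Bool) :
    val (Sum.inr z, b) (BiAlg.const (J.top : J n)) = b :=
  (congrArg (fourMem · b) (z.map_const _)).trans rfl

theorem val_bot_four (z : Hom n A (M n 0)) (b : Bool) :
    val (Sum.inr z, b) (BiAlg.const (J.bot : J n)) = !b :=
  (congrArg (fourMem · b) (z.map_const _)).trans rfl

/-- Any morphism from the dual of `A` is interpolated by elements of `A` at pairs of points. -/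
theorem Morphism.exists_val (p q : Pt n A) (hp : α.val p = true) (hq : α.val q = false) :
    ∃ a, BilatticeDuality.val p a = true ∧ BilatticeDuality.val q a = false := by
  obtain ⟨⟨j, x⟩ | z, b⟩ := p <;> obtain ⟨⟨k, y⟩ | w, c⟩ := q
  · change sixMem (α.six x) b = true at hp
    change sixMem (α.six y) c = false at hq
    change ∃ a, sixMem (x a) b = true ∧ sixMem (y a) c = false
    cases b <;> cases c
    · obtain ⟨a, h1, h2⟩ := α.exists_six_false (sixMem_false_eq_true_iff.1 hp) (sixMem_false_iff.1 hq)
      exact ⟨a, sixMem_false_eq_true_iff.2 h1, sixMem_false_iff.2 h2⟩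
    -- The constant of index n is 𝐭 in every sort k ≥ 1, so it lies in M_k \ {𝟎} but not in {𝟏},
    -- whatever `α` is.
    · exact ⟨_, val_t_last_six x false, val_t_last_six y true⟩
    · obtain ⟨a, h1, h2⟩ := α.exists_six_cross (sixMem_true_iff.1 hp) (sixMem_false_iff.1 hq)
      exact ⟨a, sixMem_true_iff.2 h1, sixMem_false_iff.2 h2⟩
    · obtain ⟨a, h1, h2⟩ := α.exists_six_true (sixMem_true_iff.1 hp) (sixMem_true_eq_false_iff.1 hq)
      exact ⟨a, sixMem_true_iff.2 h1, sixMem_true_eq_false_iff.2 h2⟩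
  · cases b
    · exact ⟨_, val_f_last_six x false, val_f_last_four w c⟩
    -- Since 𝟏 collapses to 𝐭, both filters of 𝐌_0 contain its image. Interpolation takes place in
    -- sort 0, and `upTop` or `upBot` then lifts membership to equality with 𝟏.
    · replace hp : α.six x = J.t 0 := sixMem_true_iff.1 hp
      obtain ⟨a, ha⟩ := α.exists_collapse_left (x := x) (y := w) (b := c) (by rw [hp]; rfl) hq
      cases c
      · refine ⟨upBot n a, (congrArg (sixMem · true) (x.map_upBot_six a)).trans ?_,
          (congrArg (fourMem · false) (w.map_upBot_four a)).trans ?_⟩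
        · exact (by decide : ∀ u : J 1, fourMem (collapse u) false = true →
            sixMem (J.upBot u) true = true) _ ha.1
        · exact (by decide : ∀ u : J 0, fourMem u false = false →
            fourMem (J.upBot u) false = false) _ ha.2
      · refine ⟨upTop n a, (congrArg (sixMem · true) (x.map_upTop_six a)).trans ?_,
          (congrArg (fourMem · true) (w.map_upTop_four a)).trans ?_⟩
        · exact (by decide : ∀ u : J 1, fourMem (collapse u) true = true →
            sixMem (J.upTop u) true = true) _ ha.1
        · exact (by decide : ∀ u : J 0, fourMem u true = false →
            fourMem (J.upTop u) true = false) _ ha.2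
  · cases c
    -- This is the previous case conjugated by negation. The complement of {𝐭, ⊥} is the negation of
    -- {𝐭, ⊤}, and vice versa, so `upTop` now serves `b = false` and `upBot` serves `b = true`.
    · replace hq : α.six y = J.f 0 := sixMem_false_iff.1 hq
      obtain ⟨a, ha⟩ := α.exists_collapse_right (x := z) (y := y) (b := b) hp (by rw [hq]; rfl)
      cases b
      · refine ⟨BiAlg.neg n (upTop n (BiAlg.neg n a)),
          (congrArg (fourMem · false) (?_ : _ = J.neg (J.upTop (J.neg (z a : J 0))))).trans ?_,
          (congrArg (sixMem · false) (?_ : _ = J.neg (J.upTop (J.neg (y a : J 1))))).trans ?_⟩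
        · rw [z.map_neg, z.map_upTop_four, z.map_neg]; rfl
        · exact (by decide : ∀ u : J 0, fourMem u false = true →
            fourMem (J.neg (J.upTop (J.neg u))) false = true) _ ha.1
        · rw [y.map_neg, y.map_upTop_six, y.map_neg]; rfl
        · exact (by decide : ∀ u : J 1, fourMem (collapse u) false = false →
            sixMem (J.neg (J.upTop (J.neg u))) false = false) _ ha.2
      · refine ⟨BiAlg.neg n (upBot n (BiAlg.neg n a)),
          (congrArg (fourMem · true) (?_ : _ = J.neg (J.upBot (J.neg (z a : J 0))))).trans ?_,
          (congrArg (sixMem · false) (?_ : _ = J.neg (J.upBot (J.neg (y a : J 1))))).trans ?_⟩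
        · rw [z.map_neg, z.map_upBot_four, z.map_neg]; rfl
        · exact (by decide : ∀ u : J 0, fourMem u true = true →
            fourMem (J.neg (J.upBot (J.neg u))) true = true) _ ha.1
        · rw [y.map_neg, y.map_upBot_six, y.map_neg]; rfl
        · exact (by decide : ∀ u : J 1, fourMem (collapse u) true = false →
            sixMem (J.neg (J.upBot (J.neg u))) false = false) _ ha.2
    · exact ⟨_, val_t_last_four z b, val_t_last_six y true⟩
  · change fourMem (α.four z) b = true at hp
    change fourMem (α.four w) c = false at hq
    rcases eq_or_ne b c with rfl | hbc
    · exact α.exists_four hp hq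
    · cases b
      · exact ⟨_, val_bot_four z false, (val_bot_four w c).trans (by cases c <;> simp_all)⟩
      · exact ⟨_, val_top_four z true, (val_top_four w c).trans (by cases c <;> simp_all)⟩

/-- The evaluation homomorphism is surjective, for every algebra in the signature. -/
theorem evalHom_surjective : Function.Surjective (evalHom (alterEgo n) A).toFun := by
  intro α
  change Morphism (dualD (alterEgo n) A) (alterEgo n).toMStruct at α
  obtain ⟨a, ha⟩ := exists_val_eq α.val α.continuous_val α.exists_val
  have h0 (z : Hom n A (M n 0)) : (z a : J 0) = α.four z :=
    (by decide : ∀ u v : J 0, (∀ b, fourMem u b = fourMem v b) → u = v) _ _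
      fun b => ha (Sum.inr z, b)
  refine ⟨a, Morphism.ext (funext fun k => funext fun x => ?_)⟩
  induction k using Fin.cases with
  | zero => exact h0 x
  | succ k =>
    -- `collapse` confuses only 𝟎 with 𝐟 and 𝟏 with 𝐭, and these pairs are told apart by the two
    -- filters of the sort.
    refine (by decide : ∀ u v : J 1, collapse u = collapse v → (∀ b, sixMem u b = sixMem v b) →
      u = v) (x.toFun a) (α.six x) ?_ fun b => ha (Sum.inl ⟨k, x⟩, b)
    exact (h0 ((gMap n k).comp x)).trans (α.four_gMap_comp x)

end morphism

/-! ### Quotients of `𝐉_n` -/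

/-- The index map underlying the quotient map `𝐉_n → 𝐌_k`. -/
def idx {n : ℕ} (k i : Fin (n + 1)) : Fin (level k + 1) := if i < k then 0 else Fin.last _

theorem idx_mono {n : ℕ} (k : Fin (n + 1)) : Monotone (idx k) := by
  intro i j h
  unfold idx
  split_ifs with h1 h2
  · rfl
  · exact Fin.zero_le _
  · exact absurd (h.trans_lt ‹_›) h1
  · rfl

theorem constM_f {n : ℕ} (k i : Fin (n + 1)) : constM n k (J.f i) = J.f (idx k i) :=
  (apply_ite J.f _ _ _).symm

theorem constM_t {n : ℕ} (k i : Fin (n + 1)) : constM n k (J.t i) = J.t (idx k i) :=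
  (apply_ite J.t _ _ _).symm

theorem idx_last {n : ℕ} (k : Fin (n + 1)) : idx k (Fin.last n) = Fin.last _ :=
  if_neg (Fin.le_last _).not_gt

/-- The quotient map `𝐉_n → 𝐌_k`. -/
def quot (n : ℕ) (k : Fin (n + 1)) : Hom n (J n) (M n k) where
  toFun := constM n k
  map_otimes := show ∀ x y, constM n k (J.otimes x y) = J.otimes (constM n k x) (constM n k y) by
    rintro (_ | i | i | _) (_ | j | j | _) <;>
      simp [J.otimes, constM_f, constM_t, (idx_mono k).map_max, show constM n k J.top = J.top from rfl,
        show constM n k J.bot = J.bot from rfl]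
  map_oplus := show ∀ x y, constM n k (J.oplus x y) = J.oplus (constM n k x) (constM n k y) by
    rintro (_ | i | i | _) (_ | j | j | _) <;>
      simp [J.oplus, constM_f, constM_t, (idx_mono k).map_min, show constM n k J.top = J.top from rfl,
        show constM n k J.bot = J.bot from rfl]
  map_meet := show ∀ x y, constM n k (J.meet x y) = J.meet (constM n k x) (constM n k y) by
    rintro (_ | i | i | _) (_ | j | j | _) <;>
      simp [J.meet, constM_f, constM_t, (idx_mono k).map_min, (idx_mono k).map_max, idx_last,
        show constM n k J.top = J.top from rfl, show constM n k J.bot = J.bot from rfl]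
  map_join := show ∀ x y, constM n k (J.join x y) = J.join (constM n k x) (constM n k y) by
    rintro (_ | i | i | _) (_ | j | j | _) <;>
      simp [J.join, constM_f, constM_t, (idx_mono k).map_min, (idx_mono k).map_max, idx_last,
        show constM n k J.top = J.top from rfl, show constM n k J.bot = J.bot from rfl]
  map_neg := show ∀ x, constM n k (J.neg x) = J.neg (constM n k x) by
    rintro (_ | i | i | _) <;>
      simp [J.neg, constM_f, constM_t,
        show constM n k J.top = J.top from rfl, show constM n k J.bot = J.bot from rfl]
  map_const _ := rfl

/-- A point composed with a homomorphism. -/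
def Pt.comp {n : ℕ} {A : Type u} {B : Type v} [BiAlg n A] [BiAlg n B] (h : Hom n A B) :
    Pt n B → Pt n A
  | (Sum.inl x, b) => (Sum.inl ⟨x.1, x.2.comp h⟩, b)
  | (Sum.inr z, b) => (Sum.inr (z.comp h), b)

theorem val_comp {n : ℕ} {A : Type u} {B : Type v} [BiAlg n A] [BiAlg n B] (h : Hom n A B)
    (p : Pt n B) (a : A) : val (p.comp h) a = val p (h a) := by
  obtain ⟨x | z, b⟩ := p <;> rfl

/-- The points of `𝐉_n` determine its truth order. -/
theorem J.meet_eq_left {n : ℕ} (a b : J n) (h : ∀ p : Pt n (J n), val p a = true → val p b = true) :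
    J.meet a b = a := by
  have hq (c : Bool) (k : Fin n) : sixMem (constM n k.succ a) c = true →
      sixMem (constM n k.succ b) c = true := h (Sum.inl ⟨k, quot n k.succ⟩, c)
  have hz (c : Bool) : fourMem (constM n 0 a) c = true → fourMem (constM n 0 b) c = true :=
    h (Sum.inr (quot n 0), c)
  have hzt (i : Fin (n + 1)) (c : Bool) : fourMem (constM n 0 (J.t i)) c = true := by
    rw [constM_zero_t]; rfl
  have hzf (i : Fin (n + 1)) (c : Bool) : fourMem (constM n 0 (J.f i)) c = false := by
    rw [constM_zero_f]; rfl
  have hztop (c : Bool) : fourMem (constM n 0 J.top) c = c := rfl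
  have hzbot (c : Bool) : fourMem (constM n 0 J.bot) c = !c := rfl
  have hqt (i j : Fin (n + 1)) (ha : a = J.t i) (hb : b = J.t j) : j ≤ i := by
    subst ha hb
    by_contra! hij
    -- If i < j, the sort with number j sends t_i to 𝟏 but t_j to 𝐭, so its filter {𝟏} detects the
    -- wrong order.
    obtain ⟨k, rfl⟩ := Fin.exists_succ_eq.2 (Fin.ne_zero_of_lt hij)
    have h1 : constM n k.succ (J.t i) = (J.t 0 : J 1) := if_pos hij
    have h2 : constM n k.succ (J.t k.succ) = (J.t 1 : J 1) := if_neg (lt_irrefl _)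
    have := hq true k
    rw [h1, h2] at this
    exact absurd (this rfl) (by decide)
  have hqf (i j : Fin (n + 1)) (ha : a = J.f i) (hb : b = J.f j) : i ≤ j := by
    subst ha hb
    by_contra! hij
    obtain ⟨k, rfl⟩ := Fin.exists_succ_eq.2 (Fin.ne_zero_of_lt hij)
    have h1 : constM n k.succ (J.f j) = (J.f 0 : J 1) := if_pos hij
    have h2 : constM n k.succ (J.f k.succ) = (J.f 1 : J 1) := if_neg (lt_irrefl _)
    have := hq false k
    rw [h1, h2] at this
    exact absurd (this rfl) (by decide)
  clear h hq
  rcases a with _ | i | i | _ <;> rcases b with _ | j | j | _ <;>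
    simp only [hzt, hzf, hztop, hzbot, Bool.forall_bool] at hz <;>
    simp_all [J.meet]

/-! ### Separation of elements -/

section separation

variable {n : ℕ}

/-- The points of `A` determine its truth order. -/
def PtSeparates (n : ℕ) (A : Type u) [BiAlg n A] : Prop :=
  ∀ a b : A, (∀ p : Pt n A, val p a = true → val p b = true) → BiAlg.meet n a b = a

/-- The coordinate projections of a subalgebra of a power. -/
def Subuniverse.proj {I : Type u} (S : Subuniverse n (I → J n)) (i : I) : Hom n S.carrier (J n) where
  toFun s := s.1 i
  map_otimes _ _ := rfl
  map_oplus _ _ := rfl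
  map_meet _ _ := rfl
  map_join _ _ := rfl
  map_neg _ := rfl
  map_const _ := rfl

theorem Subuniverse.ptSeparates {I : Type u} (S : Subuniverse n (I → J n)) :
    PtSeparates n S.carrier := by
  intro a b h
  refine Subtype.ext (funext fun i => J.meet_eq_left (a.1 i) (b.1 i) fun p hp => ?_)
  have := h (p.comp (S.proj i))
  rw [val_comp, val_comp] at this
  exact this hp

theorem PtSeparates.eq {A : Type u} [BiAlg n A] (hA : PtSeparates n A)
    (hcomm : ∀ a b : A, BiAlg.meet n a b = BiAlg.meet n b a) {a b : A}
    (h : ∀ p : Pt n A, val p a = val p b) : a = b := by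
  rw [← hA a b fun p hp => (h p).symm.trans hp, hcomm, hA b a fun p hp => (h p).trans hp]

theorem Subuniverse.eq_of_val {I : Type u} (S : Subuniverse n (I → J n)) {a b : S.carrier}
    (h : ∀ p : Pt n S.carrier, val p a = val p b) : a = b := by
  refine S.ptSeparates.eq (fun a b => Subtype.ext (funext fun i => ?_)) h
  have (x y : J n) : J.meet x y = J.meet y x := by
    rcases x with _ | i | i | _ <;> rcases y with _ | j | j | _ <;>
      simp [J.meet, min_comm, max_comm]
  exact this (a.1 i) (b.1 i)

/-- A quotient of a subalgebra of a power of `𝐉_n` is a distributive lattice in its truth order. -/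
abbrev truthLattice {I : Type u} {S : Subuniverse n (I → J n)} {A : Type v} [BiAlg n A]
    (φ : Hom n S.carrier A) (hφ : Function.Surjective φ.toFun) : DistribLattice A :=
  letI : Max A := ⟨BiAlg.join n⟩
  letI : Min A := ⟨BiAlg.meet n⟩
  -- Each identity is lifted along `φ` to 𝐒, where equality is tested by Boolean-valued lattice
  -- homomorphisms; it then reduces to an identity of Booleans.
  letI : Lattice A := Lattice.mk'
    (hφ.forall₂.2 fun a b => by
      change BiAlg.join n _ _ = BiAlg.join n _ _
      simp only [← φ.map_join]
      exact congrArg φ.toFun (S.eq_of_val fun p => by simp [val_join, Bool.or_comm]))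
    (hφ.forall₃.2 fun a b c => by
      change BiAlg.join n (BiAlg.join n _ _) _ = BiAlg.join n _ (BiAlg.join n _ _)
      simp only [← φ.map_join]
      exact congrArg φ.toFun (S.eq_of_val fun p => by simp [val_join, Bool.or_assoc]))
    (hφ.forall₂.2 fun a b => by
      change BiAlg.meet n _ _ = BiAlg.meet n _ _
      simp only [← φ.map_meet]
      exact congrArg φ.toFun (S.eq_of_val fun p => by simp [val_meet, Bool.and_comm]))
    (hφ.forall₃.2 fun a b c => by
      change BiAlg.meet n (BiAlg.meet n _ _) _ = BiAlg.meet n _ (BiAlg.meet n _ _)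
      simp only [← φ.map_meet]
      exact congrArg φ.toFun (S.eq_of_val fun p => by simp [val_meet, Bool.and_assoc]))
    (hφ.forall₂.2 fun a b => by
      change BiAlg.join n _ (BiAlg.meet n _ _) = _
      simp only [← φ.map_join, ← φ.map_meet]
      exact congrArg φ.toFun (S.eq_of_val fun p => by
        cases h : val p a <;> simp [val_meet, val_join, h]))
    (hφ.forall₂.2 fun a b => by
      change BiAlg.meet n _ (BiAlg.join n _ _) = _
      simp only [← φ.map_join, ← φ.map_meet]
      exact congrArg φ.toFun (S.eq_of_val fun p => by
        cases h : val p a <;> simp [val_meet, val_join, h]))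
  DistribLattice.ofInfSupLe (hφ.forall₃.2 fun a b c => le_of_eq (by
    change BiAlg.meet n _ (BiAlg.join n _ _) = BiAlg.join n (BiAlg.meet n _ _) (BiAlg.meet n _ _)
    simp only [← φ.map_join, ← φ.map_meet]
    exact congrArg φ.toFun (S.eq_of_val fun p => by
      simp [val_meet, val_join, Bool.and_or_distrib_left])))

/-- Prime filters separate the elements of a quotient of a subalgebra of a power of `𝐉_n`. -/
theorem exists_prime {I : Type u} {S : Subuniverse n (I → J n)} {A : Type v} [BiAlg n A]
    (φ : Hom n S.carrier A) (hφ : Function.Surjective φ.toFun) {a b : A} (hab : a ≠ b) :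
    ∃ v : A → Bool, v a ≠ v b ∧ (∀ x y, v (BiAlg.meet n x y) = (v x && v y)) ∧
      (∀ x y, v (BiAlg.join n x y) = (v x || v y)) ∧ v (BiAlg.const (J.t 0 : J n)) = true ∧
      v (BiAlg.const (J.f 0 : J n)) = false := by
  let := truthLattice φ hφ
  have htop (x : A) : x ≤ BiAlg.const (J.t 0 : J n) := by
    obtain ⟨s, rfl⟩ := hφ x
    refine inf_eq_left.1 ?_
    change BiAlg.meet n _ _ = _
    rw [← φ.map_const, ← φ.map_meet]
    exact congrArg φ.toFun (S.eq_of_val fun p => by simp [val_meet, val_t_zero])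
  have hbot (x : A) : BiAlg.const (J.f 0 : J n) ≤ x := by
    obtain ⟨s, rfl⟩ := hφ x
    refine inf_eq_left.1 ?_
    change BiAlg.meet n _ _ = _
    rw [← φ.map_const, ← φ.map_meet]
    exact congrArg φ.toFun (S.eq_of_val fun p => by simp [val_meet, val_f_zero])
  wlog hle : ¬ a ≤ b generalizing a b
  · obtain ⟨v, h, h'⟩ := this hab.symm fun hba => hab (le_antisymm (not_not.1 hle) hba)
    exact ⟨v, h.symm, h'⟩
  obtain ⟨K, hK, hbK, haK⟩ := DistribLattice.prime_ideal_of_disjoint_filter_ideal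
    (F := Order.PFilter.principal a) (I := Order.Ideal.principal b)
    (Set.disjoint_left.2 fun x hax hxb => hle (le_trans hax hxb))
  have hbK' : b ∈ K := hbK (Order.Ideal.mem_principal_self)
  have haK' : a ∉ K := fun h => Set.disjoint_left.1 haK (le_refl a) h
  classical
  -- The required filter is the complement of a prime ideal that contains `b` and misses `a`.
  refine ⟨fun x => decide (x ∉ K), by simp [haK', hbK'], fun x y => ?_, fun x y => ?_, ?_, ?_⟩
  · have : x ⊓ y ∈ K ↔ x ∈ K ∨ y ∈ K :=
      ⟨hK.mem_or_mem, fun h => h.elim (K.lower inf_le_left) (K.lower inf_le_right)⟩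
    change decide (x ⊓ y ∉ K) = _
    simp [this]
  · change decide (x ⊔ y ∉ K) = _
    simp [Order.Ideal.sup_mem_iff]
  · simpa using fun h => haK' (K.lower (htop a) h)
  · simpa using K.lower (hbot b) hbK'

/-- A homomorphism that is constant on the fibres of a surjective homomorphism factors through it. -/
noncomputable def Hom.desc {A : Type u} {B : Type v} {C : Type w} [BiAlg n A] [BiAlg n B] [BiAlg n C]
    (φ : Hom n A B) (hφ : Function.Surjective φ.toFun) (h : Hom n A C)
    (hh : ∀ a b, φ a = φ b → h a = h b) : Hom n B C :=
  have key (a : A) : h (Function.surjInv hφ (φ a)) = h a := hh _ _ (Function.surjInv_eq hφ _)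
  { toFun := fun b => h (Function.surjInv hφ b)
    map_otimes := hφ.forall₂.2 fun a b => by rw [← φ.map_otimes, key, key, key, h.map_otimes]
    map_oplus := hφ.forall₂.2 fun a b => by rw [← φ.map_oplus, key, key, key, h.map_oplus]
    map_meet := hφ.forall₂.2 fun a b => by rw [← φ.map_meet, key, key, key, h.map_meet]
    map_join := hφ.forall₂.2 fun a b => by rw [← φ.map_join, key, key, key, h.map_join]
    map_neg := hφ.forall.2 fun a => by rw [← φ.map_neg, key, key, h.map_neg]
    map_const := fun c => by rw [← φ.map_const, key, h.map_const] }

theorem Hom.desc_apply {A : Type u} {B : Type v} {C : Type w} [BiAlg n A] [BiAlg n B] [BiAlg n C]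
    (φ : Hom n A B) (hφ : Function.Surjective φ.toFun) (h : Hom n A C)
    (hh : ∀ a b, φ a = φ b → h a = h b) (a : A) : φ.desc hφ h hh (φ a) = h a :=
  hh _ _ (Function.surjInv_eq hφ _)

/-- A point whose filter is saturated for a surjective homomorphism factors through it. -/
theorem Pt.exists_desc {A : Type u} {B : Type v} [BiAlg n A] [BiAlg n B] (φ : Hom n A B)
    (hφ : Function.Surjective φ.toFun) (p : Pt n A) (hp : ∀ a b, φ a = φ b → val p a = val p b) :
    ∃ q : Pt n B, ∀ a, val q (φ a) = val p a := by
  have hneg {a b} (h : φ a = φ b) : φ (BiAlg.neg n a) = φ (BiAlg.neg n b) := by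
    rw [φ.map_neg, φ.map_neg, h]
  have hT {a b} (h : φ a = φ b) : φ (upTop n a) = φ (upTop n b) := by
    simp only [upTop, φ.map_otimes, φ.map_meet, h]
  have hB {a b} (h : φ a = φ b) : φ (upBot n a) = φ (upBot n b) := by
    simp only [upBot, φ.map_oplus, h]
  obtain ⟨⟨k, x⟩ | z, c⟩ := p
  -- Either filter alone, evaluated after negation and the terms `upTop` and `upBot`, separates all
  -- six elements of 𝐌_k. Terms respect the fibres of `φ`, so saturation of the filter forces `x`
  -- itself to be constant on fibres. In sort 0 negation alone is enough.
  · have hx (a b) (h : φ a = φ b) : x a = x b := by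
      have e0 := hp _ _ h
      have e1 := hp _ _ (hneg h)
      have e2 := hp _ _ (hT h)
      have e3 := hp _ _ (hB h)
      have e4 := hp _ _ (hneg (hT h))
      have e5 := hp _ _ (hneg (hB h))
      simp only [val, x.map_neg, x.map_upTop_six, x.map_upBot_six] at e0 e1 e2 e3 e4 e5
      exact (by decide : ∀ (u v : J 1) (c : Bool), sixMem u c = sixMem v c →
        sixMem (J.neg u) c = sixMem (J.neg v) c → sixMem (J.upTop u) c = sixMem (J.upTop v) c →
        sixMem (J.upBot u) c = sixMem (J.upBot v) c →
        sixMem (J.neg (J.upTop u)) c = sixMem (J.neg (J.upTop v)) c →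
        sixMem (J.neg (J.upBot u)) c = sixMem (J.neg (J.upBot v)) c → u = v) _ _ _ e0 e1 e2 e3 e4 e5
    exact ⟨(Sum.inl ⟨k, φ.desc hφ x hx⟩, c), fun a => congrArg (sixMem · c) (φ.desc_apply hφ x hx a)⟩
  · have hz (a b) (h : φ a = φ b) : z a = z b := by
      have e0 := hp _ _ h
      have e1 := hp _ _ (hneg h)
      simp only [val, z.map_neg] at e0 e1
      exact (by decide : ∀ (u v : J 0) (c : Bool), fourMem u c = fourMem v c →
        fourMem (J.neg u) c = fourMem (J.neg v) c → u = v) _ _ _ e0 e1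
    exact ⟨(Sum.inr (φ.desc hφ z hz), c), fun a => congrArg (fourMem · c) (φ.desc_apply hφ z hz a)⟩

/-- A separating prime filter on the quotient is pulled back to the subalgebra of a power, realised
there by a point, and pushed down again. -/
theorem InVariety.exists_val_ne {A : Type u} [BiAlg n A] (hA : InVariety n A) {a b : A}
    (hab : a ≠ b) : ∃ p : Pt n A, val p a ≠ val p b := by
  obtain ⟨I, S, φ, hφ⟩ := hA
  obtain ⟨v, hv, hmeet, hjoin, ht, hf⟩ := exists_prime φ hφ hab
  obtain ⟨p, hp⟩ := exists_val_eq_prime S.ptSeparates (fun s => v (φ s))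
    (fun a b => by rw [φ.map_meet, hmeet]) (fun a b => by rw [φ.map_join, hjoin])
    (by rw [φ.map_const, ht]) (by rw [φ.map_const, hf])
  obtain ⟨q, hq⟩ := Pt.exists_desc φ hφ p fun a b h => by rw [hp, hp, h]
  obtain ⟨s, rfl⟩ := hφ a
  obtain ⟨t, rfl⟩ := hφ b
  exact ⟨q, by rw [hq, hq, hp, hp]; exact hv⟩

/-- The evaluation homomorphism is injective on the algebras of the variety. -/
theorem InVariety.evalHom_injective {A : Type u} [BiAlg n A] (hA : InVariety n A) (𝔐 : AlterEgo n) :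
    Function.Injective (evalHom 𝔐 A).toFun := by
  intro a b hab
  by_contra hne
  obtain ⟨⟨⟨k, x⟩ | z, c⟩, hp⟩ := hA.exists_val_ne hne
  · exact hp (congrArg (sixMem · c) (congrFun (congrFun (congrArg Morphism.toFun hab) k.succ) x))
  · exact hp (congrArg (fourMem · c) (congrFun (congrFun (congrArg Morphism.toFun hab) 0) z))

theorem alterEgo_yieldsDuality (n : ℕ) : AlterEgo.YieldsDuality.{u} (alterEgo n) :=
  fun _ _ hA => ⟨hA.evalHom_injective _, evalHom_surjective⟩

end separation

/-! ### Binary relations as test algebras -/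

section test

variable {n : ℕ}

instance (A : Type v) [BiAlg n A] : BiAlg n (ULift.{u} A) where
  otimes x y := ⟨BiAlg.otimes n x.down y.down⟩
  oplus x y := ⟨BiAlg.oplus n x.down y.down⟩
  meet x y := ⟨BiAlg.meet n x.down y.down⟩
  join x y := ⟨BiAlg.join n x.down y.down⟩
  neg x := ⟨BiAlg.neg n x.down⟩
  const c := ⟨BiAlg.const c⟩

theorem quot_surjective (k : Fin (n + 1)) : Function.Surjective (quot n k).toFun := by
  induction k using Fin.cases with
  | zero =>
    rintro (_ | i | i | _)
    · exact ⟨J.top, rfl⟩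
    · exact ⟨J.f 0, (constM_zero_f 0).trans (congrArg J.f (Subsingleton.elim (α := Fin 1) _ _))⟩
    · exact ⟨J.t 0, (constM_zero_t 0).trans (congrArg J.t (Subsingleton.elim (α := Fin 1) _ _))⟩
    · exact ⟨J.bot, rfl⟩
  | succ k =>
    rintro (_ | i | i | _)
    · exact ⟨J.top, rfl⟩
    · rcases (by decide : ∀ i : Fin 2, i = 0 ∨ i = 1) i with h | h
      · exact ⟨J.f 0, congrArg J.f h.symm⟩
      · exact ⟨J.f (Fin.last n), (constM_f_last k).trans (congrArg J.f h.symm)⟩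
    · rcases (by decide : ∀ i : Fin 2, i = 0 ∨ i = 1) i with h | h
      · exact ⟨J.t 0, congrArg J.t h.symm⟩
      · exact ⟨J.t (Fin.last n), (constM_t_last k).trans (congrArg J.t h.symm)⟩
    · exact ⟨J.bot, rfl⟩

variable {j k : Fin (n + 1)} (r : Subuniverse n (M n j × M n k))

/-- The subalgebra with universe `r`, in an arbitrary universe level. -/
abbrev Test : Type u := ULift.{u} r.carrier

/-- The preimage of a subuniverse under a homomorphism. -/
def Subuniverse.comap {A : Type u} {B : Type v} [BiAlg n A] [BiAlg n B] (h : Hom n A B)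
    (S : Subuniverse n B) : Subuniverse n A where
  carrier := {a | h a ∈ S.carrier}
  otimes_mem a ha b hb := (congrArg (· ∈ S.carrier) (h.map_otimes a b)).mpr (S.otimes_mem _ ha _ hb)
  oplus_mem a ha b hb := (congrArg (· ∈ S.carrier) (h.map_oplus a b)).mpr (S.oplus_mem _ ha _ hb)
  meet_mem a ha b hb := (congrArg (· ∈ S.carrier) (h.map_meet a b)).mpr (S.meet_mem _ ha _ hb)
  join_mem a ha b hb := (congrArg (· ∈ S.carrier) (h.map_join a b)).mpr (S.join_mem _ ha _ hb)
  neg_mem a ha := (congrArg (· ∈ S.carrier) (h.map_neg a)).mpr (S.neg_mem _ ha)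
  const_mem c := (congrArg (· ∈ S.carrier) (h.map_const c)).mpr (S.const_mem c)

/-- The restriction of a homomorphism to the preimage of a subuniverse. -/
def Subuniverse.comapHom {A : Type u} {B : Type v} [BiAlg n A] [BiAlg n B] (h : Hom n A B)
    (S : Subuniverse n B) : Hom n (S.comap h).carrier (ULift.{w} S.carrier) where
  toFun a := ⟨⟨h a.1, a.2⟩⟩
  map_otimes a b := ULift.ext _ _ (Subtype.ext (h.map_otimes a.1 b.1))
  map_oplus a b := ULift.ext _ _ (Subtype.ext (h.map_oplus a.1 b.1))
  map_meet a b := ULift.ext _ _ (Subtype.ext (h.map_meet a.1 b.1))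
  map_join a b := ULift.ext _ _ (Subtype.ext (h.map_join a.1 b.1))
  map_neg a := ULift.ext _ _ (Subtype.ext (h.map_neg a.1))
  map_const c := ULift.ext _ _ (Subtype.ext (h.map_const c))

/-- The quotient map from the square of `𝐉_n` to `𝐌_j × 𝐌_k`. -/
def quotProd (n : ℕ) (j k : Fin (n + 1)) : Hom n (ULift.{u} Bool → J n) (M n j × M n k) where
  toFun s := (quot n j (s ⟨false⟩), quot n k (s ⟨true⟩))
  map_otimes _ _ := Prod.ext ((quot n j).map_otimes _ _) ((quot n k).map_otimes _ _)
  map_oplus _ _ := Prod.ext ((quot n j).map_oplus _ _) ((quot n k).map_oplus _ _)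
  map_meet _ _ := Prod.ext ((quot n j).map_meet _ _) ((quot n k).map_meet _ _)
  map_join _ _ := Prod.ext ((quot n j).map_join _ _) ((quot n k).map_join _ _)
  map_neg _ := Prod.ext ((quot n j).map_neg _) ((quot n k).map_neg _)
  map_const _ := rfl

/-- The preimage of `r` in the square of 𝐉_n maps onto `r`, because both quotient maps are
surjective. -/
theorem Test.inVariety : InVariety n (Test.{u} r) := by
  refine ⟨_, r.comap (quotProd n j k), r.comapHom _, ?_⟩
  rintro ⟨⟨p, q⟩, h⟩
  obtain ⟨a, rfl⟩ := quot_surjective j p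
  obtain ⟨b, rfl⟩ := quot_surjective k q
  exact ⟨⟨fun i => bif i.down then b else a, h⟩, rfl⟩

/-- The first projection. -/
def Test.fst : Hom n (Test.{u} r) (M n j) where
  toFun p := p.down.1.1
  map_otimes _ _ := rfl
  map_oplus _ _ := rfl
  map_meet _ _ := rfl
  map_join _ _ := rfl
  map_neg _ := rfl
  map_const _ := rfl

/-- The second projection. -/
def Test.snd : Hom n (Test.{u} r) (M n k) where
  toFun p := p.down.1.2
  map_otimes _ _ := rfl
  map_oplus _ _ := rfl
  map_meet _ _ := rfl
  map_join _ _ := rfl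
  map_neg _ := rfl
  map_const _ := rfl

end test

/-! ### Optimality -/

section optimal

variable {n : ℕ}

/-! ### Constants of consecutive index detect the sort. -/

theorem constM_f_eq_zero {k : Fin n} {i : Fin (n + 1)} (h : i ≤ k.castSucc) :
    constM n k.succ (J.f i) = (J.f 0 : J 1) :=
  if_pos (Fin.le_castSucc_iff.1 h)

theorem constM_f_eq_one {k : Fin n} {i : Fin (n + 1)} (h : k.succ ≤ i) :
    constM n k.succ (J.f i) = (J.f 1 : J 1) :=
  if_neg h.not_gt

theorem constM_f_ne {k : Fin n} : constM n k.succ (J.f k.castSucc) ≠ constM n k.succ (J.f k.succ) := by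
  rw [constM_f_eq_zero le_rfl, constM_f_eq_one le_rfl]
  exact (by decide : (J.f 0 : J 1) ≠ J.f 1)

/-- An algebra whose `i`-th and `(i+1)`-st false constants coincide has no point of sort `i + 1`. -/
theorem Hom.const_ne {A : Type u} [BiAlg n A] {i : Fin n} (x : Hom n A (M n i.succ)) :
    (BiAlg.const (J.f i.castSucc : J n) : A) ≠ BiAlg.const (J.f i.succ : J n) := fun h =>
  constM_f_ne ((x.map_const _).symm.trans ((congrArg x.toFun h).trans (x.map_const _)))

/-- The threshold of sort j + 1 lies between the indices j and j + 1, so it separates no other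
consecutive pair. -/
theorem constM_castSucc_eq {i j : Fin n} (h : i ≠ j) :
    constM n j.succ (J.f i.castSucc) = constM n j.succ (J.f i.succ) := by
  rcases h.lt_or_gt with h | h
  · rw [constM_f_eq_zero (Fin.castSucc_le_castSucc_iff.2 h.le),
      constM_f_eq_zero (Fin.succ_le_castSucc_iff.2 h)]
  · rw [constM_f_eq_one (Fin.succ_le_castSucc_iff.2 h), constM_f_eq_one (Fin.succ_le_succ_iff.2 h.le)]

/-- The algebra of a relation between the sorts `j + 1` and `k + 1` has no points of other sorts than
these and `0`. -/
theorem Test.eq_or_eq {j k : Fin n} (r : Subuniverse n (M n j.succ × M n k.succ)) {i : Fin n}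
    (x : Hom n (Test.{u} r) (M n i.succ)) : i = j ∨ i = k := by
  by_contra! h
  exact x.const_ne (ULift.ext _ _ (Subtype.ext
    (Prod.ext (constM_castSucc_eq h.1) (constM_castSucc_eq h.2))))

/-- The algebra of a relation on the sort `0` has no points of other sorts than `0`. -/
theorem Test.false_of_hom (r : Subuniverse n (M n 0 × M n 0)) {i : Fin n}
    (x : Hom n (Test.{u} r) (M n i.succ)) : False := by
  have h : constM n 0 (J.f i.castSucc) = constM n 0 (J.f i.succ) :=
    (constM_zero_f _).trans (constM_zero_f _).symm
  exact x.const_ne (ULift.ext _ _ (Subtype.ext (Prod.ext h h)))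

/-- A test for the failure of duality: a map of the form `x ↦ w (x c)` that preserves the structure of
the dual of `A` but is not an evaluation. -/
theorem AlterEgo.not_yieldsDuality {𝔐 : AlterEgo n} {A : Type u} [BiAlg n A] (hA : InVariety n A)
    (c : A) (w : ∀ k, M n k → M n k)
    (hop : ∀ g ∈ 𝔐.G, ∀ x : Hom n A (M n g.1), w _ (g.2.2 (x c)) = g.2.2 (w _ (x c)))
    (hrel : ∀ r ∈ 𝔐.R, ∀ (x : Hom n A (M n r.1)) (y : Hom n A (M n r.2.1)),
      (∀ a, (x a, y a) ∈ r.2.2.carrier) → (w _ (x c), w _ (y c)) ∈ r.2.2.carrier)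
    (hw : ∀ a, ¬ ∀ (k : Fin (n + 1)) (x : Hom n A (M n k)), x a = w k (x c)) :
    ¬ AlterEgo.YieldsDuality.{u} 𝔐 := by
  intro h
  let α : Morphism (dualD 𝔐 A) 𝔐.toMStruct :=
    { toFun := fun k x => w k (x.toFun c)
      continuous_toFun := fun k => (continuous_of_discreteTopology (f := w k)).comp
        ((continuous_apply c).comp continuous_induced_dom)
      map_op := fun g x => hop g.1 g.2 x
      map_rel := fun r x y hxy => hrel r.1 r.2 x y hxy }
  obtain ⟨a, ha⟩ := (h A hA).2 α
  exact hw a fun k x => congrFun (congrFun (congrArg Morphism.toFun ha) k) x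

/-- A family of self-maps of the sorts that depends only on their level. -/
def sortMap (n : ℕ) (w₀ : J 0 → J 0) (w₁ : J 1 → J 1) (k : Fin (n + 1)) : M n k → M n k :=
  Fin.cases (motive := fun k => M n k → M n k) w₀ (fun _ => w₁) k

/-- Over the algebra of ≤^{k+1} only the sorts 0 and k + 1 have points, so the erased map is the
only operation with non-empty domain. No remaining structure links the two sorts, and a morphism may
take unrelated constant values on them. As the two maps are constant, the chosen element plays no
role. -/
theorem not_yieldsDuality_eraseOp (k : Fin n) :
    ¬ AlterEgo.YieldsDuality.{u} ((alterEgo n).eraseOp ⟨k.succ, 0, gMap n k⟩) := by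
  refine AlterEgo.not_yieldsDuality (Test.inVariety (leSucc n k k le_rfl))
    (BiAlg.const (J.top : J n)) (sortMap n (fun _ => J.bot) fun _ => J.top) ?_ ?_ ?_
  · rintro _ ⟨⟨i, rfl⟩, hi⟩ x
    refine absurd ?_ hi
    rcases Test.eq_or_eq _ x with rfl | rfl <;> rfl
  · rintro _ (rfl | ⟨i, rfl⟩ | ⟨i, l, h, rfl⟩) x y -
    · exact (by decide : ((J.bot, J.bot) : J 0 × J 0) ∈ leFour)
    · exact (by decide : ((J.top, J.top) : J 1 × J 1) ∈ leSix)
    · exact (by decide : ((J.top, J.top) : J 1 × J 1) ∈ leSix)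
  · intro a h
    have h1 : Test.fst _ a = (J.top : J 1) := h k.succ (Test.fst _)
    have h2 : collapse (Test.fst _ a) = J.bot := h 0 ((gMap n k).comp (Test.fst _))
    rw [h1] at h2
    exact absurd h2 (by decide)

/-- Over the algebra of ≤^0 all sorts other than 0 are empty, so nothing remains to be preserved.
Exchanging ⊤ and ⊥ in the element (⊥, ⊤) would require the element (⊤, ⊥), which is not in the
relation. -/
theorem not_yieldsDuality_erase_leZero :
    ¬ AlterEgo.YieldsDuality.{u} ((alterEgo n).eraseRel ⟨0, 0, leZero n⟩) := by
  refine AlterEgo.not_yieldsDuality (Test.inVariety (leZero n))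
    ⟨⟨(J.bot, J.top), (by decide : ((J.bot, J.top) : J 0 × J 0) ∈ leFour)⟩⟩
    (sortMap n (fun | J.top => J.bot | J.bot => J.top | u => u) id) ?_ ?_ ?_
  · rintro _ ⟨i, rfl⟩ x
    exact (Test.false_of_hom _ x).elim
  · rintro _ ⟨rfl | ⟨i, rfl⟩ | ⟨i, l, h, rfl⟩, hi⟩ x y -
    · exact absurd rfl hi
    · exact (Test.false_of_hom _ x).elim
    · exact (Test.false_of_hom _ x).elim
  · intro a h
    have h1 : a.down.1.1 = (J.top : J 0) := h 0 (Test.fst _)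
    have h2 : a.down.1.2 = (J.bot : J 0) := h 0 (Test.snd _)
    have h3 : ((a.down.1.1, a.down.1.2) : J 0 × J 0) ∈ leFour := a.down.2
    rw [h1, h2] at h3
    exact absurd h3 (by decide)

/-- The element `(𝐟, 𝟎)` of the algebra of the relation `leSucc`. -/
def fZero {j k : Fin n} (hjk : j ≤ k) : Test.{u} (leSucc n j k hjk) :=
  ⟨⟨(J.f 1, J.f 0), (by decide : ((J.f 1, J.f 0) : J 1 × J 1) ∈ leSix)⟩⟩

/-- The constant of index k works because j + 1 ≤ k < k + 1: it is 𝐟 in sort j + 1 and 𝟎 in sort k +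
1. For j < k its value under every homomorphism is therefore forced by the sort. -/
theorem fZero_eq_const {j k : Fin n} (hjk : j < k) :
    fZero.{u} hjk.le = BiAlg.const (J.f k.castSucc : J n) :=
  ULift.ext _ _ (Subtype.ext (Prod.ext (constM_f_eq_one (Fin.succ_le_castSucc_iff.2 hjk)).symm
    (constM_f_eq_zero le_rfl).symm))

theorem eq_of_fZero_eq_one {i j k : Fin n} (hjk : j ≤ k)
    (x : Hom n (Test.{u} (leSucc n j k hjk)) (M n i.succ))
    (hx : x (fZero hjk) = (J.f 1 : J 1)) : i = j := by
  rcases Test.eq_or_eq _ x with rfl | rfl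
  · rfl
  · by_contra hne
    rw [fZero_eq_const (lt_of_le_of_ne hjk (Ne.symm hne)), x.map_const] at hx
    exact (by decide : (J.f 0 : J 1) ≠ J.f 1) ((constM_f_eq_zero le_rfl).symm.trans hx)

theorem eq_of_fZero_eq_zero {i j k : Fin n} (hjk : j ≤ k)
    (x : Hom n (Test.{u} (leSucc n j k hjk)) (M n i.succ))
    (hx : x (fZero hjk) = (J.f 0 : J 1)) : i = k := by
  rcases Test.eq_or_eq _ x with rfl | rfl
  · by_contra hne
    have hlt := lt_of_le_of_ne hjk hne
    rw [fZero_eq_const hlt, x.map_const] at hx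
    exact (by decide : (J.f 1 : J 1) ≠ J.f 0)
      ((constM_f_eq_one (Fin.succ_le_castSucc_iff.2 hlt)).symm.trans hx)
  · rfl

/-- The permutation of `J 1` that exchanges `𝟎` and `𝐟`. -/
def swapF : J 1 → J 1
  | J.f i => J.f i.rev
  | u => u

/-- The map exchanges 𝐟 and 𝟎 at (𝐟, 𝟎), so an evaluation would have to be at (𝟎, 𝐟), which is
outside the relation. The exchange is invisible after `collapse`, so the g_k and ≤^0 are respected.
-/
theorem not_yieldsDuality_erase_leSucc {j k : Fin n} (hjk : j ≤ k) :
    ¬ AlterEgo.YieldsDuality.{u} ((alterEgo n).eraseRel ⟨j.succ, k.succ, leSucc n j k hjk⟩) := by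
  have hsix {i l : Fin n} (hil : i ≤ l) (x : Hom n (Test.{u} (leSucc n j k hjk)) (M n i.succ))
      (y : Hom n (Test.{u} (leSucc n j k hjk)) (M n l.succ)) (hne : ¬(i = j ∧ l = k))
      (h : ∀ a, (x a, y a) ∈ (leSucc n i l hil).carrier) :
      (swapF (x (fZero hjk)), swapF (y (fZero hjk))) ∈ leSix := by
    have hfy : x (fZero hjk) = (J.f 1 : J 1) → y (fZero hjk) ≠ (J.f 0 : J 1) := fun hx hy =>
      hne ⟨eq_of_fZero_eq_one hjk x hx, eq_of_fZero_eq_zero hjk y hy⟩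
    -- (𝐟, 𝟎) is the only pair of `leSix` that the exchange expels, and it can occur only from sort
    -- j + 1 to sort k + 1, where the relation has been erased.
    exact (by decide : ∀ u v : J 1, (u, v) ∈ leSix → (u = J.f 1 → v ≠ J.f 0) →
      (swapF u, swapF v) ∈ leSix) _ _ (h (fZero hjk)) hfy
  refine AlterEgo.not_yieldsDuality (Test.inVariety (leSucc n j k hjk)) (fZero hjk)
    (sortMap n id swapF) ?_ ?_ ?_
  · rintro _ ⟨i, rfl⟩ x
    exact (by decide : ∀ u : J 1, collapse u = collapse (swapF u)) _
  · rintro _ ⟨rfl | ⟨i, rfl⟩ | ⟨i, l, h, rfl⟩, hi⟩ x y hxy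
    · exact hxy _
    · refine hsix le_rfl x y ?_ hxy
      rintro ⟨rfl, rfl⟩
      exact hi rfl
    · refine hsix h.le x y ?_ hxy
      rintro ⟨rfl, rfl⟩
      exact hi rfl
  · intro a h
    have h1 : a.down.1.1 = (J.f 0 : J 1) := h j.succ (Test.fst _)
    have h2 : a.down.1.2 = (J.f 1 : J 1) := h k.succ (Test.snd _)
    have h3 : ((a.down.1.1, a.down.1.2) : J 1 × J 1) ∈ leSix := a.down.2
    rw [h1, h2] at h3
    exact absurd h3 (by decide)

end optimal

end BilatticeDuality


/-- For `n ≥ 1`, the duality on the variety `𝒱_n` yielded by the multi-sorted alter ego `M̃_n` is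
optimal. -/
theorem mainTheorem3 (n : ℕ) (hn : 1 ≤ n) :
    BilatticeDuality.AlterEgo.YieldsOptimalDuality.{u} (BilatticeDuality.alterEgo n) := by
  refine ⟨BilatticeDuality.alterEgo_yieldsDuality n, ?_, ?_⟩
  · rintro _ ⟨k, rfl⟩
    exact BilatticeDuality.not_yieldsDuality_eraseOp k
  · rintro _ (rfl | ⟨k, rfl⟩ | ⟨j, k, h, rfl⟩)
    · exact BilatticeDuality.not_yieldsDuality_erase_leZero
    · exact BilatticeDuality.not_yieldsDuality_erase_leSucc le_rfl
    · exact BilatticeDuality.not_yieldsDuality_erase_leSucc h.le
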